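/- Notation. Let $I=\,]0,1]$. For a net $x:I\to\mathbb R$ and $r\in\mathbb R$ write $|x|<\alpha^r$ if $|x_\varepsilon|<\varepsilon^r$ for all small $\varepsilon$. The net is moderate if $|x|<\alpha^r$ for some $r\in\mathbb R$, negligible if $|x|<\alpha^k$ for all $k\in\mathbb N$; $\overline{\mathbb R}$ is the ring of moderate nets modulo negligible ones, with the sharp norm $\|[x]\|=e^{-\sup\{r\,:\,|x|<\alpha^r\}}$, and $\overline{\mathbb R}^n$ carries the maximum of the norms of the coordinates. $\mathbb R^n\subset\overline{\mathbb R}^n$ via constant nets. For $X\subset\mathbb R^N$, $\widetilde X_c\subset\overline{\mathbb R}^N$ is the set of classes $[(x_\varepsilon)]$ with $x_\varepsilon$ in some fixed compact subset of $X$ for small $\varepsilon$. A map $f$ between open subsets of $\overline{\mathbb R}^m$, $\overline{\mathbb R}^k$ is differentiable at $x$ with derivative the $\overline{\mathbb R}$-linear map $L$ if $\|f(y)-f(x)-L(y-x)\|/\|y-x\|\to0$ as $y\to x$; $C^r$, $C^\infty$ and $C^\infty$-diffeomorphisms are defined from this as usual. A set $S\subset\overline{\mathbb R}^N$ with a family of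 charts $(U_j,\varphi_j)$ is a generalized submanifold of codimension $N-n$ if $S\ne\emptyset$, the $U_j\neq\emptyset$ are open in $S$ and cover $S$, each $\varphi_j$ is a homeomorphism of $U_j$ onto an open subset of $\overline{\mathbb R}^n$, all transition maps are $C^\infty$-diffeomorphisms between open sets, and each $\varphi_j^{-1}$ is a $C^\infty$ immersion into $\overline{\mathbb R}^N$ (injective derivatives). Let $M\ne\emptyset$ be an $n$-dimensional (embedded) $C^\infty$ submanifold of $\mathbb R^N$ with an atlas $(U_a,\phi_a)_{a\in\Lambda}$ of nonempty charts, $\phi_a$ mapping $U_a$ onto an open subset of $\mathbb R^n$. For $\lambda:I\to\Lambda$ of finite range let $U_\lambda$ be the part of $\widetilde M_c$ in the strongly internal set $\langle U_{\lambda(\varepsilon)}\rangle$ relative to $M$ (the $p\in\widetilde M_c$ each of whose representatives in $M$ satisfies $p_\varepsilon\in U_{\lambda(\varepsilon)}$ for small $\varepsilon$), let $\phi_\lambda([p_\varepsilon])=[\phi_{\lambda(\varepsilon)}(p_\varepsilon)]$, and let $U_\lambda^c$ be the set of $p$ with a representative satisfying $p_\varepsilon\in K_{\lambda(\varepsilon)}$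 for small $\varepsilon$, for some compact sets $K_a\subset U_a$. Theorem. Suppose that each local chart $\phi_a$ and its inverse are Lipschitz (with constants that may depend on $a$). Then: 1. $M\subset\widetilde M_c$ is a discrete subset, and distinct points of $M$ have sharp distance $1$. 2. For each $\lambda$ of finite range, $U_\lambda^c\subset U_\lambda$, $U_\lambda$ is nonempty and open in $\widetilde M_c$, $\phi_\lambda$ is well defined on $U_\lambda$ and is an isometry for the sharp norms onto an open subset of $\overline{\mathbb R}^n$ contained in the strongly internal set $\langle\phi_{\lambda(\varepsilon)}(U_{\lambda(\varepsilon)})\rangle$; and $\widetilde M_c=\bigcup_\lambda U_\lambda$. 3. $\widetilde M_c$ with the charts $(U^c_\lambda,\phi_\lambda)$, $\lambda$ of finite range, is a generalized submanifold of $\overline{\mathbb R}^N$ of codimension $N-n$. If moreover, for every $a\in\Lambda$, every $k$ and every compact $K\subset M$, the derivatives of order $k$ of $\phi_a^{-1}$ are bounded on $\phi_a(U_a\cap K)$, then $\widetilde M_c$ with the atlas $\{(U_\lambda,\phi_\lambda):\lambda\text{ of finite range}\}$ is a generalized submanifold of $\overline{\mathbb R}^N$ of codimension $N-n$. 4. The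 geometry of $\widetilde M_c$ extends that of $M$. For constant $\lambda=a$: $U_a$ (generalized) meets $M$ in $U_a$ (classical) and there the generalized chart equals $\phi_a$; at the points of $\phi_a(U_a)\subset\mathbb R^n$ the derivative of the inverse of the generalized chart, and at the points of $\phi_a(U_a\cap U_b)$ that of the generalized change of charts, is the $\overline{\mathbb R}$-linear extension of the derivative of $\phi_a^{-1}$, respectively of $\phi_b\circ\phi_a^{-1}$. If $M$ is connected and $d_M(p,q)$ denotes the infimum of the lengths of curves in $M$ from $p$ to $q$, then $D([p_\varepsilon],[q_\varepsilon])=[d_M(p_\varepsilon,q_\varepsilon)]$ (representatives in a compact subset of $M$) is a well-defined map $\widetilde M_c\times\widetilde M_c\to\overline{\mathbb R}$ with $\|D(p,q)\|=\|p-q\|$. -/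

import Mathlib

open Set Filter Topology Asymptotics
open scoped ContDiff

namespace Colombeau

/-! ### Nets indexed by `]0,1]` -/

/-- The index set `I = ]0,1]`. -/
abbrev Idx : Type := Set.Ioc (0 : ℝ) 1

/-- The filter "`ε ∈ I` is small": a property holds eventually iff it holds on some `]0,η]`. -/
def small : Filter Idx := Filter.comap Subtype.val (𝓝 (0 : ℝ))

/-- The set of exponents `r` such that `|x| < α^r`, where `α(ε) = ε`. -/
def orders (x : Idx → ℝ) : Set ℝ := {r : ℝ | ∀ᶠ ε in small, |x ε| < (ε : ℝ) ^ r}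

/-- A net is moderate if `|x| < α^r` for some real `r`. -/
def IsModerate (x : Idx → ℝ) : Prop := (orders x).Nonempty

/-- A net is negligible if `|x| < α^n` for every natural number `n`. -/
def IsNegligible (x : Idx → ℝ) : Prop := ∀ n : ℕ, ∀ᶠ ε in small, |x ε| < (ε : ℝ) ^ n

/-- `e^{-V(x)}` with `V(x) = sup {r : |x| < α^r}`, written as the infimum of the `e^{-r}`
(so it is `0` when `V(x) = ∞`). -/
noncomputable def netNorm (x : Idx → ℝ) : ℝ := sInf ((fun r : ℝ => Real.exp (-r)) '' orders x)

theorem eventually_small_lt {c : ℝ} (hc : 0 < c) : ∀ᶠ ε : Idx in small, (ε : ℝ) < c := by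
  have h : ∀ᶠ t : ℝ in 𝓝 0, t < c := eventually_lt_nhds hc
  exact h.comap _

theorem orders_anti {x : Idx → ℝ} {r s : ℝ} (hr : r ∈ orders x) (h : s ≤ r) : s ∈ orders x := by
  have hr' : ∀ᶠ ε in small, |x ε| < (ε : ℝ) ^ r := hr
  refine Filter.Eventually.mono hr' fun ε hε => hε.trans_le ?_
  exact Real.rpow_le_rpow_of_exponent_ge ε.2.1 ε.2.2 h

/-- `C α^r < α^t` as soon as `t < r`. -/
theorem eventually_const_mul_rpow_lt (C : ℝ) {r t : ℝ} (h : t < r) :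
    ∀ᶠ ε : Idx in small, C * (ε : ℝ) ^ r < (ε : ℝ) ^ t := by
  have h1 : Tendsto (fun e : ℝ => C * e ^ (r - t)) (𝓝 0) (𝓝 (C * 0 ^ (r - t))) :=
    ((Real.continuousAt_rpow_const 0 (r - t) (Or.inr (by linarith))).tendsto).const_mul C
  rw [Real.zero_rpow (by linarith), mul_zero] at h1
  have h2 : ∀ᶠ e : ℝ in 𝓝 0, C * e ^ (r - t) < 1 := h1.eventually (eventually_lt_nhds one_pos)
  refine (h2.comap (Subtype.val : Idx → ℝ)).mono fun ε hε => ?_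
  have hp : 0 < (ε : ℝ) ^ t := Real.rpow_pos_of_pos ε.2.1 t
  have he : (ε : ℝ) ^ r = (ε : ℝ) ^ (r - t) * (ε : ℝ) ^ t := by
    rw [← Real.rpow_add ε.2.1]; congr 1; ring
  rw [he, ← mul_assoc]
  nlinarith

theorem orders_add {x y : Idx → ℝ} {r t : ℝ} (hx : r ∈ orders x) (hy : r ∈ orders y)
    (h : t < r) : t ∈ orders (x + y) := by
  have hx' : ∀ᶠ ε in small, |x ε| < (ε : ℝ) ^ r := hx
  have hy' : ∀ᶠ ε in small, |y ε| < (ε : ℝ) ^ r := hy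
  show ∀ᶠ ε in small, |(x + y) ε| < (ε : ℝ) ^ t
  filter_upwards [hx', hy', eventually_const_mul_rpow_lt 2 h] with ε h1 h2 h3
  have := abs_add_le (x ε) (y ε)
  simp only [Pi.add_apply]
  linarith

theorem orders_neg (x : Idx → ℝ) : orders (-x) = orders x := by
  ext r; simp [orders]

theorem orders_mul {x y : Idx → ℝ} {r s : ℝ} (hx : r ∈ orders x) (hy : s ∈ orders y) :
    r + s ∈ orders (x * y) := by
  have hx' : ∀ᶠ ε in small, |x ε| < (ε : ℝ) ^ r := hx
  have hy' : ∀ᶠ ε in small, |y ε| < (ε : ℝ) ^ s := hy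
  show ∀ᶠ ε in small, |(x * y) ε| < (ε : ℝ) ^ (r + s)
  filter_upwards [hx', hy'] with ε h1 h2
  rw [Pi.mul_apply, abs_mul, Real.rpow_add ε.2.1]
  exact mul_lt_mul'' h1 h2 (abs_nonneg _) (abs_nonneg _)

theorem isModerate_const (c : ℝ) : IsModerate (fun _ => c) := by
  refine ⟨-1, ?_⟩
  show ∀ᶠ ε : Idx in small, |c| < (ε : ℝ) ^ (-1 : ℝ)
  have := eventually_const_mul_rpow_lt |c| (r := 0) (t := -1) (by norm_num)
  filter_upwards [this] with ε hε
  simpa using hε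

theorem isModerate_add {x y : Idx → ℝ} (hx : IsModerate x) (hy : IsModerate y) :
    IsModerate (x + y) := by
  obtain ⟨r, hr⟩ := hx
  obtain ⟨s, hs⟩ := hy
  exact ⟨min r s - 1, orders_add (orders_anti hr (min_le_left r s))
    (orders_anti hs (min_le_right r s)) (by linarith)⟩

theorem isNegligible_iff {x : Idx → ℝ} : IsNegligible x ↔ ∀ r : ℝ, r ∈ orders x := by
  constructor
  · intro h r
    obtain ⟨n, hn⟩ := exists_nat_ge r
    refine orders_anti (r := (n : ℝ)) ?_ hn
    refine (h n).mono fun ε hε => ?_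
    simpa using hε
  · intro h n
    have h1 : ∀ᶠ ε in small, |x ε| < (ε : ℝ) ^ (n : ℝ) := h n
    refine h1.mono fun ε hε => ?_
    simpa using hε

/-- The ring `𝓔_M` of moderate nets. -/
def moderateNets : Subring (Idx → ℝ) where
  carrier := {x | IsModerate x}
  mul_mem' := fun ⟨_, hr⟩ ⟨_, hs⟩ => ⟨_, orders_mul hr hs⟩
  one_mem' := isModerate_const 1
  add_mem' := isModerate_add
  zero_mem' := isModerate_const 0
  neg_mem' := fun {x} ⟨r, hr⟩ => ⟨r, by rw [orders_neg]; exact hr⟩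

/-- The ideal `𝓘` of negligible nets. -/
def negligibleNets : Ideal moderateNets where
  carrier := {x | IsNegligible x.1}
  add_mem' := by
    intro x y hx hy
    rw [Set.mem_ofPred_eq, isNegligible_iff] at *
    intro r
    exact orders_add (hx (r + 1)) (hy (r + 1)) (by linarith)
  zero_mem' := by
    rw [Set.mem_ofPred_eq, isNegligible_iff]
    intro r
    show ∀ᶠ ε : Idx in small, |(0 : ℝ)| < (ε : ℝ) ^ r
    refine Filter.Eventually.of_forall fun ε => ?_
    simpa using Real.rpow_pos_of_pos ε.2.1 r
  smul_mem' := by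
    intro c x hx
    rw [Set.mem_ofPred_eq, isNegligible_iff] at *
    intro r
    obtain ⟨s, hs⟩ := c.2
    have := orders_mul hs (hx (r - s))
    rwa [add_sub_cancel] at this

/-! ### The ring of Colombeau generalized real numbers and the sharp norm -/

/-- The ring `ℝ̄ = 𝓔_M / 𝓘`. -/
def GReal : Type := moderateNets ⧸ negligibleNets

noncomputable instance : CommRing GReal :=
  inferInstanceAs (CommRing (moderateNets ⧸ negligibleNets))

/-- The class of a moderate net. -/
def GReal.mk : moderateNets →+* GReal := Ideal.Quotient.mk negligibleNets

theorem GReal.mk_surjective : Function.Surjective GReal.mk := Ideal.Quotient.mk_surjective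

theorem GReal.mk_eq_mk_iff {x y : moderateNets} :
    GReal.mk x = GReal.mk y ↔ IsNegligible (x.1 - y.1) := by
  have : GReal.mk x = GReal.mk y ↔ x - y ∈ negligibleNets := Ideal.Quotient.eq
  exact this

theorem netNorm_le {x : Idx → ℝ} {r : ℝ} (h : r ∈ orders x) : netNorm x ≤ Real.exp (-r) :=
  csInf_le ⟨0, by rintro _ ⟨s, -, rfl⟩; positivity⟩ ⟨r, h, rfl⟩

theorem netNorm_nonneg (x : Idx → ℝ) : 0 ≤ netNorm x :=
  Real.sInf_nonneg (by rintro _ ⟨s, -, rfl⟩; positivity)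

theorem exists_order_of_netNorm_lt {x : Idx → ℝ} (hx : IsModerate x) {c : ℝ}
    (h : netNorm x < c) : ∃ r ∈ orders x, Real.exp (-r) < c := by
  obtain ⟨_, ⟨r, hr, rfl⟩, hc⟩ := exists_lt_of_csInf_lt (hx.image _) h
  exact ⟨r, hr, hc⟩

theorem netNorm_eq_zero_iff {x : Idx → ℝ} (hx : IsModerate x) :
    netNorm x = 0 ↔ IsNegligible x := by
  rw [isNegligible_iff]
  constructor
  · intro h r
    obtain ⟨s, hs, hlt⟩ := exists_order_of_netNorm_lt hx (c := Real.exp (-r))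
      (by rw [h]; positivity)
    exact orders_anti hs (by have := Real.exp_lt_exp.1 hlt; linarith)
  · intro h
    refine le_antisymm (le_of_forall_pos_lt_add fun c hc => ?_) (netNorm_nonneg x)
    refine (netNorm_le (h (-Real.log c + 1))).trans_lt ?_
    rw [zero_add]
    calc Real.exp (-(-Real.log c + 1)) < Real.exp (Real.log c) := Real.exp_lt_exp.2 (by linarith)
      _ = c := Real.exp_log hc

theorem netNorm_add_le_max {x y : Idx → ℝ} (hx : IsModerate x) (hy : IsModerate y) :
    netNorm (x + y) ≤ max (netNorm x) (netNorm y) := by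
  refine le_of_forall_gt fun c hc => ?_
  obtain ⟨r, hr, hrc⟩ := exists_order_of_netNorm_lt hx ((le_max_left _ _).trans_lt hc)
  obtain ⟨s, hs, hsc⟩ := exists_order_of_netNorm_lt hy ((le_max_right _ _).trans_lt hc)
  have hc0 : 0 < c := (Real.exp_pos _).trans hrc
  have h1 : -r < Real.log c := (Real.lt_log_iff_exp_lt hc0).2 hrc
  have h2 : -s < Real.log c := (Real.lt_log_iff_exp_lt hc0).2 hsc
  have h3 : -Real.log c < min r s := lt_min (by linarith) (by linarith)
  obtain ⟨t, ht1, ht2⟩ := exists_between h3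
  refine (netNorm_le (orders_add (orders_anti hr (min_le_left r s))
    (orders_anti hs (min_le_right r s)) ht2)).trans_lt ?_
  exact (Real.lt_log_iff_exp_lt hc0).1 (by linarith)

theorem netNorm_congr {x y : Idx → ℝ} (hx : IsModerate x) (h : IsNegligible (y - x)) :
    netNorm y ≤ netNorm x := by
  have hm : IsModerate (y - x) := ⟨0, isNegligible_iff.1 h 0⟩
  have h1 := netNorm_add_le_max hx hm
  rw [(netNorm_eq_zero_iff hm).2 h, add_sub_cancel, max_eq_left (netNorm_nonneg x)] at h1
  exact h1

/-- The sharp norm of a generalized number: `e^{-V(x)}` for a representative `x`;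
by `sharpNorm_mk` the choice of the representative is immaterial. -/
noncomputable def sharpNorm (a : GReal) : ℝ :=
  netNorm (Function.surjInv GReal.mk_surjective a).1

theorem sharpNorm_mk (x : moderateNets) : sharpNorm (GReal.mk x) = netNorm x.1 := by
  have h := GReal.mk_eq_mk_iff.1 (Function.surjInv_eq GReal.mk_surjective (GReal.mk x))
  have h' := GReal.mk_eq_mk_iff.1 (Function.surjInv_eq GReal.mk_surjective (GReal.mk x)).symm
  exact le_antisymm (netNorm_congr x.2 h) (netNorm_congr (Subtype.property _) h')

/-- `ℝ̄` with the sharp norm; its topology is the sharp topology. The space `ℝ̄ⁿ` is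
`Fin n → GReal` with the induced maximum norm. -/
noncomputable instance : NormedAddCommGroup GReal :=
  AddGroupNorm.toNormedAddCommGroup
    { toFun := sharpNorm
      map_zero' := by
        rw [← map_zero GReal.mk, sharpNorm_mk]
        refine (netNorm_eq_zero_iff (isModerate_const 0)).2 ?_
        exact negligibleNets.zero_mem
      add_le' := by
        intro a b
        obtain ⟨x, rfl⟩ := GReal.mk_surjective a
        obtain ⟨y, rfl⟩ := GReal.mk_surjective b
        rw [← map_add, sharpNorm_mk, sharpNorm_mk, sharpNorm_mk]
        exact (netNorm_add_le_max x.2 y.2).trans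
          (max_le_add_of_nonneg (netNorm_nonneg _) (netNorm_nonneg _))
      neg' := by
        intro a
        obtain ⟨x, rfl⟩ := GReal.mk_surjective a
        rw [← map_neg, sharpNorm_mk, sharpNorm_mk]
        show sInf (_ '' orders (-x.1)) = _
        rw [orders_neg]; rfl
      eq_zero_of_map_eq_zero' := by
        intro a ha
        obtain ⟨x, rfl⟩ := GReal.mk_surjective a
        rw [sharpNorm_mk, netNorm_eq_zero_iff x.2] at ha
        rw [← map_zero GReal.mk]
        refine GReal.mk_eq_mk_iff.2 ?_
        simpa using ha }

/-- The space `ℝ̄ⁿ`. -/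
abbrev GVec (n : ℕ) : Type := Fin n → GReal

/-- The Euclidean space `ℝⁿ`. -/
abbrev Euc (n : ℕ) : Type := EuclideanSpace ℝ (Fin n)

open Classical in
/-- The class in `ℝ̄` of a net (meaningful for moderate nets). -/
noncomputable def netClass (x : Idx → ℝ) : GReal :=
  if h : IsModerate x then GReal.mk ⟨x, h⟩ else 0

/-- The class in `ℝ̄ⁿ` of a net in `ℝⁿ` (meaningful for moderate nets). -/
noncomputable def vecClass {n : ℕ} (x : Idx → Euc n) : GVec n := fun i => netClass fun ε => x ε i

/-- `x` is a moderate net in `ℝⁿ` that represents the point `p` of `ℝ̄ⁿ`. -/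
def Represents {n : ℕ} (x : Idx → Euc n) (p : GVec n) : Prop :=
  (∀ i, IsModerate fun ε => x ε i) ∧ vecClass x = p

/-- The embedding `ℝ → ℝ̄` by constant nets. -/
noncomputable def ofReal (c : ℝ) : GReal := netClass fun _ => c

/-- The embedding `ℝⁿ → ℝ̄ⁿ` by constant nets. -/
noncomputable def ofVec {n : ℕ} (v : Euc n) : GVec n := vecClass fun _ => v

/-- The `ℝ̄`-linear extension `ℝ̄ᵐ → ℝ̄ᵏ` of an `ℝ`-linear map `ℝᵐ → ℝᵏ` (same matrix). -/
noncomputable def extendLinear {m k : ℕ} (T : Euc m →L[ℝ] Euc k) : GVec m →ₗ[GReal] GVec k :=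
  Matrix.toLin' (Matrix.of fun i j => ofReal (T (EuclideanSpace.single j 1) i))

/-- `X̃_c`: the points of `ℝ̄ⁿ` having a representative that eventually stays in a
compact subset of `X`. -/
def tildeC {n : ℕ} (X : Set (Euc n)) : Set (GVec n) :=
  {p | ∃ x, Represents x p ∧ ∃ K, IsCompact K ∧ K ⊆ X ∧ ∀ᶠ ε in small, x ε ∈ K}

/-- The strongly internal set `⟨A_ε⟩` relative to `X`: the points `p` with a representative
in `X` and such that every representative of `p` in `X` lies in `A_ε` for small `ε`.
For `X = univ` this is the usual strongly internal set. -/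
def stronglyInternal {n : ℕ} (X : Set (Euc n)) (A : Idx → Set (Euc n)) : Set (GVec n) :=
  {p | (∃ x, Represents x p ∧ ∀ᶠ ε in small, x ε ∈ X) ∧
    ∀ x, Represents x p → (∀ᶠ ε in small, x ε ∈ X) → ∀ᶠ ε in small, x ε ∈ A ε}

/-! ### Generalized differential calculus -/

/-- Newton differentiability in the sharp topology: `L` is `ℝ̄`-linear and
`‖f y - f x - L (y - x)‖ / ‖y - x‖ → 0` as `y → x`. -/
def HasGDerivAt {m k : ℕ} (f : GVec m → GVec k) (L : GVec m →ₗ[GReal] GVec k) (x : GVec m) :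
    Prop :=
  (fun y => f y - f x - L (y - x)) =o[𝓝 x] fun y => y - x

/-- `f` is of class `C^r` on the (open) set `U`. -/
def GContDiffOn {m k : ℕ} : ℕ → (GVec m → GVec k) → Set (GVec m) → Prop
  | 0, f, U => ContinuousOn f U
  | r + 1, f, U => ∃ L : GVec m → (GVec m →ₗ[GReal] GVec k),
      (∀ x ∈ U, HasGDerivAt f (L x) x) ∧
      ∀ j : Fin m, GContDiffOn r (fun x => L x (Pi.single j 1)) U

/-- `f` is of class `C^∞` on the (open) set `U`. -/
def GSmoothOn {m k : ℕ} (f : GVec m → GVec k) (U : Set (GVec m)) : Prop :=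
  ∀ r : ℕ, GContDiffOn r f U

/-- `f` restricts to a `C^∞` diffeomorphism of `U` onto `V`. -/
def IsGDiffeo {m k : ℕ} (f : GVec m → GVec k) (U : Set (GVec m)) (V : Set (GVec k)) : Prop :=
  IsOpen U ∧ IsOpen V ∧ MapsTo f U V ∧ GSmoothOn f U ∧
    ∃ g : GVec k → GVec m, MapsTo g V U ∧ InvOn g f U V ∧ GSmoothOn g V

/-! ### Generalized manifolds -/

/-- The inverse of a chart `φ` with domain `U`. -/
noncomputable def chartInv {N n : ℕ} (U : Set (GVec N)) (φ : GVec N → GVec n) :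
    GVec n → GVec N :=
  Function.invFunOn φ U

/-- The family of charts `(U j, φ j)` is a `𝒢`-atlas of dimension `n` and class `C^∞` of the
set `S ⊆ ℝ̄ᴺ`, the domains being open in `S` for the induced topology. -/
structure IsGAtlas {N n : ℕ} {J : Type*} (S : Set (GVec N)) (U : J → Set (GVec N))
    (φ : J → GVec N → GVec n) : Prop where
  nonempty : S.Nonempty
  dom_nonempty : ∀ j, (U j).Nonempty
  dom_open : ∀ j, ∃ O, IsOpen O ∧ U j = S ∩ O
  injOn : ∀ j, InjOn (φ j) (U j)
  image_open : ∀ j, IsOpen (φ j '' U j)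
  cover : ⋃ j, U j = S
  transition : ∀ i j, (U i ∩ U j).Nonempty →
    IsGDiffeo (φ j ∘ chartInv (U i) (φ i)) (φ i '' (U i ∩ U j)) (φ j '' (U i ∩ U j))

/-- The set `S ⊆ ℝ̄ᴺ` with the charts `(U j, φ j)` is a generalized submanifold of `ℝ̄ᴺ` of
codimension `c`: it is a generalized manifold of dimension `n = N - c`, and the inclusion
`S → ℝ̄ᴺ` is an embedding, i.e. a `C^∞` immersion (read in the charts) which is a homeomorphism
onto its image (the charts are homeomorphisms for the induced topology). -/
structure IsGSubmanifold {N n : ℕ} {J : Type*} (c : ℕ) (S : Set (GVec N))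
    (U : J → Set (GVec N)) (φ : J → GVec N → GVec n) : Prop extends IsGAtlas S U φ where
  codim : n + c = N
  continuousOn : ∀ j, ContinuousOn (φ j) (U j)
  continuousOn_inv : ∀ j, ContinuousOn (chartInv (U j) (φ j)) (φ j '' U j)
  smooth_inclusion : ∀ j, GSmoothOn (chartInv (U j) (φ j)) (φ j '' U j)
  immersion : ∀ j, ∀ y ∈ φ j '' U j, ∃ L, HasGDerivAt (chartInv (U j) (φ j)) L y ∧
    Function.Injective L

/-! ### Classical submanifolds and the charts they induce -/

/-- An atlas, indexed by `Λ`, of an `n`-dimensional (embedded) `C^∞` submanifold `M` of `ℝᴺ`: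
the charts `chart a` are homeomorphisms of the nonempty open subsets `dom a` of `M`, which
cover `M`, onto open subsets of `ℝⁿ`, and their inverses `param a` are `C^∞` immersions. -/
structure SubmanifoldAtlas {N : ℕ} (M : Set (Euc N)) (n : ℕ) (Λ : Type*) where
  dom : Λ → Set (Euc N)
  chart : Λ → Euc N → Euc n
  param : Λ → Euc n → Euc N
  dom_nonempty : ∀ a, (dom a).Nonempty
  dom_open : ∀ a, ∃ O, IsOpen O ∧ dom a = M ∩ O
  cover : ⋃ a, dom a = M
  image_open : ∀ a, IsOpen (chart a '' dom a)
  left_inv : ∀ a, ∀ p ∈ dom a, param a (chart a p) = p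
  chart_continuousOn : ∀ a, ContinuousOn (chart a) (dom a)
  param_contDiffOn : ∀ a, ContDiffOn ℝ ∞ (param a) (chart a '' dom a)
  param_immersion : ∀ a, ∀ y ∈ chart a '' dom a, Function.Injective (fderiv ℝ (param a) y)

namespace SubmanifoldAtlas

variable {N n : ℕ} {M : Set (Euc N)} {Λ : Type*} (A : SubmanifoldAtlas M n Λ)

/-- The local charts and their inverses are Lipschitz (with constants depending on the chart). -/
def IsLipschitz : Prop :=
  ∀ a, (∃ L, LipschitzOnWith L (A.chart a) (A.dom a)) ∧
    ∃ L, LipschitzOnWith L (A.param a) (A.chart a '' A.dom a)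

/-- Over each compact subset of `M`, the derivatives of all orders of the local
parametrizations are bounded. -/
def HasBoundedDerivatives : Prop :=
  ∀ a, ∀ k : ℕ, ∀ K, IsCompact K → K ⊆ M →
    ∃ C : ℝ, ∀ y ∈ A.chart a '' A.dom a, A.param a y ∈ K → ‖iteratedFDeriv ℝ k (A.param a) y‖ ≤ C

/-- `U_l`, for a map `l : I → Λ`: the part of `M̃_c` in the strongly internal set
`⟨U_{l(ε)}⟩` (relative to `M`). -/
def gDom (l : Idx → Λ) : Set (GVec N) :=
  tildeC M ∩ stronglyInternal M fun ε => A.dom (l ε)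

/-- The points of `U_l` having a representative that eventually stays in compact subsets
of the chart domains. -/
def gDomC (l : Idx → Λ) : Set (GVec N) :=
  {p | ∃ x, Represents x p ∧ ∃ K : Λ → Set (Euc N), (∀ a, IsCompact (K a) ∧ K a ⊆ A.dom a) ∧
    ∀ᶠ ε in small, x ε ∈ K (l ε)}

open Classical in
/-- `φ_l ([x_ε]) = [φ_{l(ε)} (x_ε)]`, computed with some representative `(x_ε)` such that
`x_ε ∈ U_{l(ε)}` for small `ε` (and `0` where there is none). -/
noncomputable def gChart (l : Idx → Λ) (p : GVec N) : GVec n :=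
  if h : ∃ x, Represents x p ∧ ∀ᶠ ε in small, x ε ∈ A.dom (l ε) then
    vecClass fun ε => A.chart (l ε) (h.choose ε)
  else 0

/-- The inverse `φ_l⁻¹` of the chart `φ_l : U_l → ℝ̄ⁿ`. -/
noncomputable def gParam (l : Idx → Λ) : GVec n → GVec N := chartInv (A.gDom l) (A.gChart l)

end SubmanifoldAtlas

/-- The maps `I → Λ` of finite range. -/
abbrev FinRange (Λ : Type*) : Type _ := {l : Idx → Λ // (Set.range l).Finite}

/-- The distance in `M`: the infimum of the lengths of the curves in `M` joining `p` to `q`. -/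
noncomputable def intrinsicDist {N : ℕ} (M : Set (Euc N)) (p q : Euc N) : ℝ :=
  (⨅ γ ∈ {γ : ℝ → Euc N | ContinuousOn γ (Icc 0 1) ∧ MapsTo γ (Icc 0 1) M ∧ γ 0 = p ∧ γ 1 = q},
    eVariationOn γ (Icc 0 1)).toReal

end Colombeau

open Colombeau

namespace Colombeau

/-! ### Nets and the sharp norm -/

/-! The sharp norm sees only the order of a net in powers of `ε`: by `netNorm_mono`, `|u| ≤ C |v|`
for small `ε` gives `‖u‖ ≤ ‖v‖` whatever `C` is. Hence a net of maps that is Lipschitz with a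
uniform constant becomes distance-nonincreasing, and bi-Lipschitz charts become isometries
(`norm_gChart_sub`). Since `l` has finite range, constants that depend on the chart are
automatically uniform in `ε`. Nonzero real constants have norm 1, which makes `M` discrete.

Openness is a statement about balls of radius `ε^r`. If every representative of `p` in `M`
eventually lies in the chart domains, then whole balls of `M` of some radius `ε^m` do: otherwise a
representative could be moved by a negligible amount out of the domains
(`exists_ball_subset_dom_of_mem_gDom`). On the coordinate side, a connectedness argument shows that
the image of a chart contains a ball of comparable radius (`ball_subset_codom`). Together they make
both `U_l` and its image open.

For differentiability, consider smooth maps `f_ε` with derivatives bounded uniformly on `B(x_ε,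
ε^r)`. Taylor's formula bounds the remainder by `C |y - x|²`, so the induced map has a remainder at
most `‖q - p‖²` in the sharp norm; partial derivatives are of the same kind, and induction gives
`C^∞` (`NetSmoothOn.gSmoothOn`). The required bounds for the parametrizations come from compactness
on `U_l^c` and from the extra hypothesis on `U_l`. For changes of charts they follow from `D(φ_b
φ_a⁻¹) = T⁺ ∘ Dφ_a⁻¹`, with `T = Dφ_b⁻¹` and `T⁺ = (T* T)⁻¹ T*`: the Lipschitz chart bounds `T` from
below, so `T` stays in a compact set of injective maps, where `T⁺` is smooth (`change_derivBdd`).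
The derivative of an inverse chart is injective because that inverse is an isometry
(`HasGDerivAt.injective`).

Finally, on a compact subset of a connected `M` the intrinsic distance lies between the ambient
distance and a multiple of it, so both have the same sharp norm. -/

instance small_neBot : small.NeBot := by
  refine Filter.comap_neBot fun t ht => ?_
  obtain ⟨δ, hδ, hs⟩ := Metric.mem_nhds_iff.1 ht
  refine ⟨⟨min 1 (δ / 2), by positivity, min_le_left _ _⟩, hs ?_⟩
  have h0 : 0 < min 1 (δ / 2) := by positivity
  rw [Metric.mem_ball, Real.dist_eq, sub_zero, abs_of_pos h0]
  exact (min_le_right _ _).trans_lt (by linarith)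

/-- The set of orders is downward closed but its supremum need not belong to it; hence the strict
inequality on the right. -/
theorem netNorm_le_iff {x : Idx → ℝ} (hx : IsModerate x) {c : ℝ} (hc : 0 ≤ c) :
    netNorm x ≤ c ↔ ∀ r, c < Real.exp (-r) → r ∈ orders x := by
  constructor
  · intro h r hr
    obtain ⟨s, hs, hlt⟩ := exists_order_of_netNorm_lt hx (h.trans_lt hr)
    exact orders_anti hs (by have := Real.exp_lt_exp.1 hlt; linarith)
  · intro h
    refine le_of_forall_pos_le_add fun η hη => ?_
    have h1 : Real.exp (-(-Real.log (c + η))) = c + η := by rw [neg_neg, Real.exp_log (by linarith)]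
    rw [← h1]
    exact netNorm_le (h _ (by rw [h1]; linarith))

/-- Any loss in the exponent, however small, absorbs the constant `C`. -/
theorem mem_orders_of_le {u v : Idx → ℝ} {C r s : ℝ} (hv : r ∈ orders v)
    (h : ∀ᶠ ε in small, |u ε| ≤ C * |v ε|) (hs : s < r) : s ∈ orders u := by
  have hv' : ∀ᶠ ε in small, |v ε| < (ε : ℝ) ^ r := hv
  show ∀ᶠ ε in small, |u ε| < (ε : ℝ) ^ s
  filter_upwards [hv', h, eventually_const_mul_rpow_lt |C| hs] with ε h1 h2 h3
  calc |u ε| ≤ C * |v ε| := h2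
    _ ≤ |C| * |v ε| := by gcongr; exact le_abs_self C
    _ ≤ |C| * (ε : ℝ) ^ r := by gcongr
    _ < _ := h3

theorem IsModerate.of_le {u v : Idx → ℝ} (hv : IsModerate v) {C : ℝ}
    (h : ∀ᶠ ε in small, |u ε| ≤ C * |v ε|) : IsModerate u := by
  obtain ⟨r, hr⟩ := hv
  exact ⟨r - 1, mem_orders_of_le hr h (by linarith)⟩

theorem IsModerate.of_bounded {u : Idx → ℝ} {C : ℝ} (h : ∀ᶠ ε in small, |u ε| ≤ C) :
    IsModerate u :=
  (isModerate_const 1).of_le (C := C) (by simpa using h)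

/-- The constant costs an arbitrarily small part of the exponent, which the infimum does not notice.
This is the mechanism that turns Lipschitz estimates into estimates with constant 1. -/
theorem netNorm_mono {u v : Idx → ℝ} (hv : IsModerate v) {C : ℝ}
    (h : ∀ᶠ ε in small, |u ε| ≤ C * |v ε|) : netNorm u ≤ netNorm v := by
  rw [netNorm_le_iff (hv.of_le h) (netNorm_nonneg v)]
  intro r hr
  obtain ⟨s, hs, hlt⟩ := exists_order_of_netNorm_lt hv hr
  exact mem_orders_of_le hs h (by have := Real.exp_lt_exp.1 hlt; linarith)

theorem IsNegligible.of_le {u v : Idx → ℝ} (hv : IsNegligible v) {C : ℝ}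
    (h : ∀ᶠ ε in small, |u ε| ≤ C * |v ε|) : IsNegligible u := by
  rw [isNegligible_iff] at *
  exact fun r => mem_orders_of_le (hv (r + 1)) h (by linarith)

theorem IsNegligible.isModerate {u : Idx → ℝ} (hu : IsNegligible u) : IsModerate u :=
  ⟨0, isNegligible_iff.1 hu 0⟩

theorem netNorm_mul_le {u v : Idx → ℝ} (hu : IsModerate u) (hv : IsModerate v) :
    netNorm (u * v) ≤ netNorm u * netNorm v := by
  have key : ∀ a, netNorm u < a → ∀ b, netNorm v < b → netNorm (u * v) ≤ a * b := by
    intro a ha b hb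
    obtain ⟨r, hr, hra⟩ := exists_order_of_netNorm_lt hu ha
    obtain ⟨s, hs, hsb⟩ := exists_order_of_netNorm_lt hv hb
    refine (netNorm_le (orders_mul hr hs)).trans ?_
    rw [neg_add, Real.exp_add]
    exact mul_le_mul hra.le hsb.le (Real.exp_pos _).le ((Real.exp_pos _).trans hra).le
  exact le_mul_of_forall_lt₀ key

theorem netNorm_const {c : ℝ} (hc : c ≠ 0) : netNorm (fun _ => c) = 1 := by
  refine le_antisymm ?_ ?_
  · rw [netNorm_le_iff (isModerate_const c) zero_le_one]
    intro r hr
    have hr' : r < 0 := by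
      have := Real.one_lt_exp_iff.1 hr; linarith
    show ∀ᶠ ε : Idx in small, |c| < (ε : ℝ) ^ r
    filter_upwards [eventually_const_mul_rpow_lt |c| hr'] with ε hε
    simpa using hε
  · by_contra h
    push Not at h
    obtain ⟨r, hr, hr1⟩ := exists_order_of_netNorm_lt (isModerate_const c) h
    have hr0 : 0 < r := by
      have := Real.exp_lt_one_iff.1 hr1; linarith
    have hr' : ∀ᶠ ε : Idx in small, |c| < (ε : ℝ) ^ r := hr
    -- With target exponent 0 the second condition reads `ε^r < |c|`, against the first.
    obtain ⟨ε, h1, h2⟩ := (hr'.and (eventually_const_mul_rpow_lt |c|⁻¹ hr0)).exists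
    rw [Real.rpow_zero, inv_mul_lt_iff₀ (abs_pos.2 hc)] at h2
    linarith

/-! ### Classes of nets -/

theorem netClass_of {x : Idx → ℝ} (h : IsModerate x) : netClass x = GReal.mk ⟨x, h⟩ := dif_pos h

theorem norm_netClass {x : Idx → ℝ} (h : IsModerate x) : ‖netClass x‖ = netNorm x := by
  rw [netClass_of h]; exact sharpNorm_mk _

theorem netClass_eq_iff {x y : Idx → ℝ} (hx : IsModerate x) (hy : IsModerate y) :
    netClass x = netClass y ↔ IsNegligible (x - y) := by
  rw [netClass_of hx, netClass_of hy, GReal.mk_eq_mk_iff]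

theorem netClass_add {x y : Idx → ℝ} (hx : IsModerate x) (hy : IsModerate y) :
    netClass (x + y) = netClass x + netClass y := by
  rw [netClass_of hx, netClass_of hy, netClass_of (isModerate_add hx hy), ← map_add]; rfl

theorem IsModerate.neg {x : Idx → ℝ} (hx : IsModerate x) : IsModerate (-x) := by
  obtain ⟨r, hr⟩ := hx
  exact ⟨r, by rwa [orders_neg]⟩

theorem IsModerate.sub {x y : Idx → ℝ} (hx : IsModerate x) (hy : IsModerate y) :
    IsModerate (x - y) := by
  rw [sub_eq_add_neg]; exact isModerate_add hx hy.neg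

theorem IsModerate.mul {x y : Idx → ℝ} (hx : IsModerate x) (hy : IsModerate y) :
    IsModerate (x * y) := by
  obtain ⟨r, hr⟩ := hx
  obtain ⟨s, hs⟩ := hy
  exact ⟨_, orders_mul hr hs⟩

theorem IsModerate.sum {ι : Type*} (s : Finset ι) {x : ι → Idx → ℝ} (h : ∀ i, IsModerate (x i)) :
    IsModerate (∑ i ∈ s, x i) := by
  classical
  induction s using Finset.induction_on with
  | empty => exact isModerate_const 0
  | insert a s ha ih => rw [Finset.sum_insert ha]; exact isModerate_add (h a) ih

theorem netClass_sub {x y : Idx → ℝ} (hx : IsModerate x) (hy : IsModerate y) :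
    netClass (x - y) = netClass x - netClass y := by
  rw [netClass_of hx, netClass_of hy, netClass_of (hx.sub hy), ← map_sub]; rfl

theorem netClass_mul {x y : Idx → ℝ} (hx : IsModerate x) (hy : IsModerate y) :
    netClass (x * y) = netClass x * netClass y := by
  rw [netClass_of hx, netClass_of hy, netClass_of (hx.mul hy), ← map_mul]; rfl

theorem netClass_zero : netClass (0 : Idx → ℝ) = 0 := by
  have h : IsModerate (0 : Idx → ℝ) := isModerate_const 0
  rw [netClass_of h]; exact map_zero GReal.mk

theorem netClass_sum {ι : Type*} (s : Finset ι) {x : ι → Idx → ℝ} (h : ∀ i, IsModerate (x i)) :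
    netClass (∑ i ∈ s, x i) = ∑ i ∈ s, netClass (x i) := by
  classical
  induction s using Finset.induction_on with
  | empty => simpa using netClass_zero
  | insert a s ha ih =>
    rw [Finset.sum_insert ha, Finset.sum_insert ha, netClass_add (h a) (IsModerate.sum s h), ih]

/-! ### Representatives of points of `ℝ̄ⁿ` -/

variable {m k n : ℕ}

theorem abs_coord_le (v : Euc n) (i : Fin n) : |v i| ≤ ‖v‖ := by
  simpa using PiLp.norm_apply_le v i

theorem norm_le_sum_abs (v : Euc n) : ‖v‖ ≤ ∑ i, |v i| := by
  rw [EuclideanSpace.norm_eq]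
  refine Real.sqrt_le_iff.2 ⟨by positivity, ?_⟩
  simpa using Finset.sum_sq_le_sq_sum_of_nonneg (s := Finset.univ) (f := fun i => |v i|)
    (fun i _ => abs_nonneg _)

theorem Represents.isModerate_norm {x : Idx → Euc n} {p : GVec n} (h : Represents x p) :
    IsModerate fun ε => ‖x ε‖ := by
  have hi : ∀ i, IsModerate fun ε => |x ε i| := fun i =>
    (h.1 i).of_le (C := 1) (by simp)
  refine (IsModerate.sum Finset.univ hi).of_le (C := 1) (Eventually.of_forall fun ε => ?_)
  rw [abs_norm, one_mul, Finset.sum_apply]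
  exact (norm_le_sum_abs _).trans (le_abs_self _)

/-- The Euclidean and maximum norms are comparable up to constants depending on `n` only, which the
sharp norm ignores; so estimates can be made on Euclidean norms of representatives. -/
theorem Represents.netNorm_norm {x : Idx → Euc n} {p : GVec n} (h : Represents x p) :
    (netNorm fun ε => ‖x ε‖) = ‖p‖ := by
  have hc : ∀ i, ‖p i‖ = netNorm fun ε => x ε i := fun i => by
    rw [← norm_netClass (h.1 i), ← h.2]; rfl
  refine le_antisymm ?_ ?_
  · rw [netNorm_le_iff h.isModerate_norm (norm_nonneg p)]
    intro r hr
    -- The intermediate value provides an exponent `s > r`; the gap absorbs the factor `n`.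
    obtain ⟨c, hc1, hc2⟩ := exists_between hr
    have hc0 : 0 < c := (norm_nonneg p).trans_lt hc1
    obtain ⟨s, rfl⟩ : ∃ s, c = Real.exp (-s) := ⟨-Real.log c, by rw [neg_neg, Real.exp_log hc0]⟩
    have hs : r < s := by have := Real.exp_lt_exp.1 hc2; linarith
    have h1 : ∀ᶠ ε in small, ∀ i, |x ε i| < (ε : ℝ) ^ s := by
      rw [eventually_all]
      intro i
      refine (netNorm_le_iff (h.1 i) (norm_nonneg p)).1 ?_ s hc1
      rw [← hc i]; exact norm_le_pi_norm p i
    show ∀ᶠ ε in small, |‖x ε‖| < (ε : ℝ) ^ r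
    filter_upwards [h1, eventually_const_mul_rpow_lt n hs] with ε h2 h3
    rw [abs_norm]
    calc ‖x ε‖ ≤ ∑ i, |x ε i| := norm_le_sum_abs _
      _ ≤ ∑ _i : Fin n, (ε : ℝ) ^ s := Finset.sum_le_sum fun i _ => (h2 i).le
      _ = n * (ε : ℝ) ^ s := by simp
      _ < _ := h3
  · rw [pi_norm_le_iff_of_nonneg (netNorm_nonneg _)]
    intro i
    rw [hc i]
    refine netNorm_mono h.isModerate_norm (C := 1) (Eventually.of_forall fun ε => ?_)
    simpa using abs_coord_le (x ε) i

theorem Represents.sub {x y : Idx → Euc n} {p q : GVec n} (hx : Represents x p)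
    (hy : Represents y q) : Represents (fun ε => x ε - y ε) (p - q) := by
  refine ⟨fun i => (hx.1 i).sub (hy.1 i), ?_⟩
  rw [← hx.2, ← hy.2]
  ext i
  exact netClass_sub (hx.1 i) (hy.1 i)

theorem represents_of_moderate {x : Idx → Euc n} (h : IsModerate fun ε => ‖x ε‖) :
    Represents x (vecClass x) :=
  ⟨fun i => h.of_le (C := 1) (Eventually.of_forall fun ε => by
    simpa using abs_coord_le (x ε) i), rfl⟩

theorem represents_of_bounded {x : Idx → Euc n} {C : ℝ} (h : ∀ᶠ ε in small, ‖x ε‖ ≤ C) :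
    Represents x (vecClass x) :=
  represents_of_moderate (IsModerate.of_bounded (C := C) (by simpa using h))

theorem represents_const (v : Euc n) : Represents (fun _ => v) (ofVec v) :=
  represents_of_bounded (C := ‖v‖) (by simp)

theorem exists_represents (p : GVec n) : ∃ x, Represents x p := by
  choose u hu using fun i => GReal.mk_surjective (p i)
  refine ⟨fun ε => WithLp.toLp 2 fun i => (u i).1 ε, fun i => (u i).2, ?_⟩
  ext i
  rw [← hu i]
  exact netClass_of (u i).2

theorem Represents.eq_iff {x y : Idx → Euc n} {p q : GVec n} (hx : Represents x p)
    (hy : Represents y q) : p = q ↔ IsNegligible fun ε => ‖x ε - y ε‖ := by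
  rw [← netNorm_eq_zero_iff (hx.sub hy).isModerate_norm, (hx.sub hy).netNorm_norm, norm_sub_eq_zero_iff]

theorem Represents.negligible {x y : Idx → Euc n} {p : GVec n} (hx : Represents x p)
    (hy : Represents y p) : IsNegligible fun ε => ‖x ε - y ε‖ := (hx.eq_iff hy).1 rfl

theorem Represents.of_negligible {x y : Idx → Euc n} {p : GVec n} (hx : Represents x p)
    (h : IsNegligible fun ε => ‖y ε - x ε‖) : Represents y p := by
  have hy : Represents y (vecClass y) := by
    refine represents_of_moderate ?_
    refine (isModerate_add hx.isModerate_norm h.isModerate).of_le (C := 1)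
      (Eventually.of_forall fun ε => ?_)
    rw [abs_norm, one_mul, Pi.add_apply]
    refine le_trans ?_ (le_abs_self _)
    simpa using norm_add_le (x ε) (y ε - x ε)
  rwa [(hy.eq_iff hx).2 h] at hy

theorem isNegligible_zero : IsNegligible (fun _ => 0) :=
  (netNorm_eq_zero_iff (isModerate_const 0)).1 (by
    have := norm_netClass (isModerate_const 0)
    rw [← this]
    exact (congrArg norm netClass_zero).trans norm_zero)

theorem Represents.congr {x y : Idx → Euc n} {p : GVec n} (hx : Represents x p)
    (h : ∀ᶠ ε in small, y ε = x ε) : Represents y p :=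
  hx.of_negligible (isNegligible_zero.of_le (C := 1) (by
    filter_upwards [h] with ε hε; simp [hε]))

/-- The dictionary between topologies: a sharp ball of radius `e^{-r}` gives pointwise balls of
radius `ε^r` for any representatives. -/
theorem Represents.eventually_lt {x y : Idx → Euc n} {p q : GVec n} (hx : Represents x p)
    (hy : Represents y q) {r : ℝ} (h : ‖p - q‖ < Real.exp (-r)) :
    ∀ᶠ ε in small, ‖x ε - y ε‖ < (ε : ℝ) ^ r := by
  have h1 := hx.sub hy
  have h2 : r ∈ orders fun ε => ‖x ε - y ε‖ :=
    (netNorm_le_iff h1.isModerate_norm (norm_nonneg _)).1 h1.netNorm_norm.le r h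
  simpa [orders] using h2

theorem Represents.eventually_lt_self {x y : Idx → Euc n} {p : GVec n} (hx : Represents x p)
    (hy : Represents y p) (r : ℝ) : ∀ᶠ ε in small, ‖x ε - y ε‖ < (ε : ℝ) ^ r :=
  hx.eventually_lt hy (by simpa using Real.exp_pos _)

theorem Represents.norm_sub_le {x y : Idx → Euc n} {p q : GVec n} {x' y' : Idx → Euc m}
    {p' q' : GVec m} (hx : Represents x p) (hy : Represents y q) (hx' : Represents x' p')
    (hy' : Represents y' q') {C : ℝ}
    (h : ∀ᶠ ε in small, ‖x ε - y ε‖ ≤ C * ‖x' ε - y' ε‖) : ‖p - q‖ ≤ ‖p' - q'‖ := by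
  rw [← (hx.sub hy).netNorm_norm, ← (hx'.sub hy').netNorm_norm]
  exact netNorm_mono (hx'.sub hy').isModerate_norm (C := C) (by simpa using h)

/-- A bounded net of linear maps acts on `ℝ̄ᵐ` by the classes of its matrix entries. -/
theorem Represents.clm_apply {u : Idx → Euc m} {w : GVec m} (hu : Represents u w)
    {T : Idx → Euc m →L[ℝ] Euc k} {C : ℝ} (hT : ∀ᶠ ε in small, ‖T ε‖ ≤ C) :
    Represents (fun ε => T ε (u ε)) (Matrix.toLin'
      (Matrix.of fun i j => netClass fun ε => T ε (EuclideanSpace.single j 1) i) w) := by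
  have hT' : ∀ i j, IsModerate fun ε => T ε (EuclideanSpace.single j 1) i := fun i j => by
    refine IsModerate.of_bounded (C := C) ?_
    filter_upwards [hT] with ε hε
    refine (abs_coord_le _ i).trans (((T ε).le_opNorm _).trans ?_)
    simpa using hε
  have hexp : ∀ i, (fun ε => T ε (u ε) i) =
      ∑ j, (fun ε => T ε (EuclideanSpace.single j 1) i) * fun ε => u ε j := by
    intro i
    ext ε
    have h1 : u ε = ∑ j, u ε j • EuclideanSpace.single j (1 : ℝ) := by
      ext l; simp [Pi.single_apply]
    conv_lhs => rw [h1]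
    simp [mul_comm]
  refine ⟨fun i => ?_, ?_⟩
  · rw [hexp i]
    exact IsModerate.sum _ fun j => (hT' i j).mul (hu.1 j)
  · ext i
    show netClass (fun ε => T ε (u ε) i) = _
    rw [hexp i, netClass_sum _ fun j => (hT' i j).mul (hu.1 j), Matrix.toLin'_apply, Matrix.mulVec,
      dotProduct]
    refine Finset.sum_congr rfl fun j _ => ?_
    rw [netClass_mul (hT' i j) (hu.1 j), ← hu.2]; rfl

theorem norm_ofVec_sub_ofVec {v w : Euc n} (h : v ≠ w) : ‖ofVec v - ofVec w‖ = 1 := by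
  rw [← ((represents_const v).sub (represents_const w)).netNorm_norm]
  exact netNorm_const (norm_ne_zero_iff.2 (sub_ne_zero.2 h))

/-! ### Nets of smooth maps -/

/-- The smooth maps `f_ε` have bounded derivatives of all orders on the balls `B(x_ε, ε^r)`,
for some `r`. -/
def NetSmoothAt (f : Idx → Euc m → Euc k) (x : Idx → Euc m) : Prop :=
  ∃ r : ℝ, (∀ᶠ ε in small, ContDiffOn ℝ ∞ (f ε) (Metric.ball (x ε) ((ε : ℝ) ^ r))) ∧
    ∀ j : ℕ, ∃ C : ℝ, ∀ᶠ ε in small, ∀ z ∈ Metric.ball (x ε) ((ε : ℝ) ^ r),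
      ‖iteratedFDeriv ℝ j (f ε) z‖ ≤ C

/-- The `ℝ̄`-linear map given by the classes of the partial derivatives along a net. -/
noncomputable def netDeriv (f : Idx → Euc m → Euc k) (x : Idx → Euc m) :
    GVec m →ₗ[GReal] GVec k :=
  Matrix.toLin' (Matrix.of fun i j =>
    netClass fun ε => fderiv ℝ (f ε) (x ε) (EuclideanSpace.single j 1) i)

/-! ### Taylor estimates on balls -/

section Taylor

variable {E F : Type*} [NormedAddCommGroup E] [NormedSpace ℝ E] [NormedAddCommGroup F]
  [NormedSpace ℝ F] {f : E → F} {x z : E} {ρ C : ℝ}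

theorem norm_image_sub_le_of_iteratedFDeriv_one (hf : DifferentiableOn ℝ f (Metric.ball x ρ))
    (hC : ∀ y ∈ Metric.ball x ρ, ‖iteratedFDeriv ℝ 1 f y‖ ≤ C) (hz : z ∈ Metric.ball x ρ) :
    ‖f z - f x‖ ≤ C * ‖z - x‖ := by
  have hx : x ∈ Metric.ball x ρ := Metric.mem_ball_self (Metric.pos_of_mem_ball hz)
  refine (convex_ball x ρ).norm_image_sub_le_of_norm_fderiv_le
    (fun y hy => hf.differentiableAt (Metric.isOpen_ball.mem_nhds hy)) (fun y hy => ?_) hx hz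
  rw [← norm_iteratedFDeriv_one]
  exact hC y hy

/-- The mean value inequality is used twice: for `fderiv ℝ f`, then for `f` minus its linear part.
The closed ball of radius `‖z - x‖` is where the first estimate is uniformly `C * ‖z - x‖`. -/
theorem norm_taylor_two_le (hf : ContDiffOn ℝ ∞ f (Metric.ball x ρ))
    (hC : ∀ y ∈ Metric.ball x ρ, ‖iteratedFDeriv ℝ 2 f y‖ ≤ C) (hz : z ∈ Metric.ball x ρ) :
    ‖f z - f x - fderiv ℝ f x (z - x)‖ ≤ C * ‖z - x‖ ^ 2 := by
  have hx : x ∈ Metric.ball x ρ := Metric.mem_ball_self (Metric.pos_of_mem_ball hz)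
  have hC0 : 0 ≤ C := (norm_nonneg _).trans (hC x hx)
  have hd : DifferentiableOn ℝ (fderiv ℝ f) (Metric.ball x ρ) :=
    (hf.fderiv_of_isOpen Metric.isOpen_ball (m := ∞) (by simp)).differentiableOn (by simp)
  have hsub : Metric.closedBall x ‖z - x‖ ⊆ Metric.ball x ρ :=
    Metric.closedBall_subset_ball (by rwa [mem_ball_iff_norm] at hz)
  have h1 : ∀ y ∈ Metric.closedBall x ‖z - x‖, ‖fderiv ℝ f y - fderiv ℝ f x‖ ≤ C * ‖z - x‖ := by
    intro y hy
    refine (norm_image_sub_le_of_iteratedFDeriv_one hd (fun w hw => ?_) (hsub hy)).trans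
      (mul_le_mul_of_nonneg_left (by rwa [mem_closedBall_iff_norm] at hy) hC0)
    rw [norm_iteratedFDeriv_fderiv]
    exact hC w hw
  have h2 := (convex_closedBall x ‖z - x‖).norm_image_sub_le_of_norm_fderiv_le' (x := x) (y := z)
    (fun y hy => (hf.differentiableOn (by simp)).differentiableAt
      (Metric.isOpen_ball.mem_nhds (hsub hy))) h1 (by simp) (by simp [dist_eq_norm])
  refine h2.trans_eq (by ring)

end Taylor

theorem NetSmoothAt.fderiv_bounded {f : Idx → Euc m → Euc k} {x : Idx → Euc m}
    (hf : NetSmoothAt f x) : ∃ C, ∀ᶠ ε in small, ‖fderiv ℝ (f ε) (x ε)‖ ≤ C := by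
  obtain ⟨r, -, hr⟩ := hf
  obtain ⟨C, hC⟩ := hr 1
  refine ⟨C, hC.mono fun ε hε => ?_⟩
  rw [← norm_iteratedFDeriv_one]
  exact hε _ (Metric.mem_ball_self (Real.rpow_pos_of_pos ε.2.1 r))

theorem NetSmoothAt.represents {f : Idx → Euc m → Euc k} {x : Idx → Euc m}
    (hf : NetSmoothAt f x) :
    Represents (fun ε => f ε (x ε)) (vecClass fun ε => f ε (x ε)) := by
  obtain ⟨r, -, hr⟩ := hf
  obtain ⟨C, hC⟩ := hr 0
  refine represents_of_bounded (C := C) (hC.mono fun ε hε => ?_)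
  simpa using hε _ (Metric.mem_ball_self (Real.rpow_pos_of_pos ε.2.1 r))

theorem eventually_norm_lt_exp {p : GVec m} (r : ℝ) : ∀ᶠ q in 𝓝 p, ‖q - p‖ < Real.exp (-r) := by
  have := Metric.ball_mem_nhds p (Real.exp_pos (-r))
  filter_upwards [this] with q hq
  rwa [mem_ball_iff_norm] at hq

/-- A map represented near `p` by a net of smooth maps with bounded derivatives is
differentiable at `p`, with a quadratic remainder. -/
theorem NetSmoothAt.hasGDerivAt {f : Idx → Euc m → Euc k} {x : Idx → Euc m} {p : GVec m}
    {F : GVec m → GVec k} (hf : NetSmoothAt f x) (hx : Represents x p)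
    (hp : F p = vecClass fun ε => f ε (x ε))
    (hF : ∀ᶠ q in 𝓝 p, ∃ y, Represents y q ∧ Represents (fun ε => f ε (y ε)) (F q)) :
    HasGDerivAt F (netDeriv f x) p := by
  have hfx := hf.represents
  rw [← hp] at hfx
  obtain ⟨D, hD⟩ := hf.fderiv_bounded
  obtain ⟨r, hr1, hr⟩ := hf
  obtain ⟨C, hC⟩ := hr 2
  -- For `q` within `e^{-r}` of `p`, the representative lies in the ball of radius `ε^r` where
  -- Taylor's formula is available; the constant of the remainder disappears in the sharp norm.
  have key : ∀ᶠ q in 𝓝 p, ‖F q - F p - netDeriv f x (q - p)‖ ≤ ‖q - p‖ * ‖q - p‖ := by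
    filter_upwards [hF, eventually_norm_lt_exp r] with q ⟨y, hy, hfy⟩ hq
    have h1 := (hfy.sub hfx).sub ((hy.sub hx).clm_apply hD)
    have hm := (hy.sub hx).isModerate_norm
    have h2 := netNorm_mul_le hm hm
    rw [(hy.sub hx).netNorm_norm] at h2
    refine le_trans ?_ h2
    unfold netDeriv
    rw [← h1.netNorm_norm]
    refine netNorm_mono (hm.mul hm) (C := C) ?_
    filter_upwards [hy.eventually_lt hx hq, hr1, hC] with ε h3 h4 h5
    have h6 := norm_taylor_two_le h4 h5 (z := y ε) (by rwa [mem_ball_iff_norm])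
    rw [abs_norm, Pi.mul_apply, abs_mul, abs_norm, ← sq]
    exact h6
  refine IsLittleO.of_bound fun c hc => ?_
  have h1 : ∀ᶠ q in 𝓝 p, ‖q - p‖ < c := by
    filter_upwards [Metric.ball_mem_nhds p hc] with q hq
    rwa [mem_ball_iff_norm] at hq
  filter_upwards [key, h1] with q h2 h3
  exact h2.trans (mul_le_mul_of_nonneg_right h3.le (norm_nonneg _))

theorem NetSmoothAt.continuousAt {f : Idx → Euc m → Euc k} {x : Idx → Euc m} {p : GVec m}
    {F : GVec m → GVec k} (hf : NetSmoothAt f x) (hx : Represents x p)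
    (hp : F p = vecClass fun ε => f ε (x ε))
    (hF : ∀ᶠ q in 𝓝 p, ∃ y, Represents y q ∧ Represents (fun ε => f ε (y ε)) (F q)) :
    ContinuousAt F p := by
  have hfx := hf.represents
  rw [← hp] at hfx
  obtain ⟨r, hr1, hr⟩ := hf
  obtain ⟨C, hC⟩ := hr 1
  have key : ∀ᶠ q in 𝓝 p, ‖F q - F p‖ ≤ ‖q - p‖ := by
    filter_upwards [hF, eventually_norm_lt_exp r] with q ⟨y, hy, hfy⟩ hq
    refine hfy.norm_sub_le hfx hy hx (C := C) ?_
    filter_upwards [hy.eventually_lt hx hq, hr1, hC] with ε h3 h4 h5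
    exact norm_image_sub_le_of_iteratedFDeriv_one (h4.differentiableOn (by simp)) h5
      (by rwa [mem_ball_iff_norm])
  rw [ContinuousAt, tendsto_iff_norm_sub_tendsto_zero]
  refine squeeze_zero' (Eventually.of_forall fun _ => norm_nonneg _) key ?_
  have : Tendsto (fun q : GVec m => ‖q - p‖) (𝓝 p) (𝓝 ‖p - p‖) :=
    ((continuous_id.sub continuous_const).norm).tendsto p
  simpa using this

/-- The partial derivatives of a net of smooth maps with bounded derivatives. -/
theorem NetSmoothAt.partial {f : Idx → Euc m → Euc k} {x : Idx → Euc m} (hf : NetSmoothAt f x)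
    (v : Euc m) : NetSmoothAt (fun ε z => fderiv ℝ (f ε) z v) x := by
  obtain ⟨r, hr1, hr⟩ := hf
  have hd : ∀ᶠ ε in small,
      ContDiffOn ℝ ∞ (fderiv ℝ (f ε)) (Metric.ball (x ε) ((ε : ℝ) ^ r)) :=
    hr1.mono fun ε hε => hε.fderiv_of_isOpen Metric.isOpen_ball (by simp)
  refine ⟨r, hd.mono fun ε hε => hε.clm_apply contDiffOn_const, fun j => ?_⟩
  obtain ⟨C, hC⟩ := hr (j + 1)
  refine ⟨‖v‖ * C, ?_⟩
  filter_upwards [hd, hC] with ε h1 h2 z hz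
  refine (norm_iteratedFDeriv_clm_apply_const
    (h1.contDiffAt (Metric.isOpen_ball.mem_nhds hz)) (by exact_mod_cast le_top)).trans ?_
  rw [norm_iteratedFDeriv_fderiv]
  exact mul_le_mul_of_nonneg_left (h2 z hz) (norm_nonneg _)

/-- `F` is given on `U` by the net `f` of smooth maps with bounded derivatives. -/
def NetSmoothOn (f : Idx → Euc m → Euc k) (F : GVec m → GVec k) (U : Set (GVec m)) : Prop :=
  ∀ p ∈ U, ∃ x, Represents x p ∧ NetSmoothAt f x ∧ F p = vecClass fun ε => f ε (x ε)

theorem NetSmoothOn.eventually_represents {f : Idx → Euc m → Euc k} {F : GVec m → GVec k}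
    {U : Set (GVec m)} (h : NetSmoothOn f F U) (hU : IsOpen U) {p : GVec m} (hp : p ∈ U) :
    ∀ᶠ q in 𝓝 p, ∃ y, Represents y q ∧ Represents (fun ε => f ε (y ε)) (F q) := by
  filter_upwards [hU.mem_nhds hp] with q hq
  obtain ⟨y, hy, h1, h2⟩ := h q hq
  exact ⟨y, hy, by rw [h2]; exact h1.represents⟩

/-- Induction on the order, for all nets at once: the partial derivatives of `F` are given by the
nets of classical partial derivatives, which satisfy the same hypothesis. -/
theorem NetSmoothOn.gSmoothOn {f : Idx → Euc m → Euc k} {F : GVec m → GVec k}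
    {U : Set (GVec m)} (h : NetSmoothOn f F U) (hU : IsOpen U) : GSmoothOn F U := by
  intro r
  induction r generalizing f F with
  | zero =>
    intro p hp
    obtain ⟨x, hx, h1, h2⟩ := h p hp
    exact (h1.continuousAt hx h2 (h.eventually_represents hU hp)).continuousWithinAt
  | succ r ih =>
    choose! x hx h1 h2 using h
    have h : NetSmoothOn f F U := fun p hp => ⟨x p, hx p hp, h1 p hp, h2 p hp⟩
    refine ⟨fun p => netDeriv f (x p), fun p hp =>
      (h1 p hp).hasGDerivAt (hx p hp) (h2 p hp) (h.eventually_represents hU hp), fun j => ?_⟩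
    refine ih (f := fun ε z => fderiv ℝ (f ε) z (EuclideanSpace.single j 1)) fun p hp =>
      ⟨x p, hx p hp, (h1 p hp).partial _, ?_⟩
    ext i
    simp [netDeriv, vecClass]

/-! ### Classical submanifolds -/

/-- A Lebesgue number argument: local compact neighbourhoods combine into one compact thickening
with a uniform radius. -/
theorem exists_compact_of_locally {E : Type*} [PseudoMetricSpace E] {X Y K : Set E}
    (h : ∀ p ∈ X, ∃ r > 0, ∃ C, IsCompact C ∧ C ⊆ X ∧ Y ∩ Metric.ball p r ⊆ C)
    (hK : IsCompact K) (hKX : K ⊆ X) :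
    ∃ δ > 0, ∃ C, IsCompact C ∧ C ⊆ X ∧ ∀ x ∈ K, Y ∩ Metric.ball x δ ⊆ C := by
  refine hK.induction_on
    (p := fun K => ∃ δ > 0, ∃ C, IsCompact C ∧ C ⊆ X ∧ ∀ x ∈ K, Y ∩ Metric.ball x δ ⊆ C)
    ⟨1, one_pos, ∅, isCompact_empty, empty_subset _, by simp⟩ ?_ ?_ ?_
  · rintro s t hst ⟨δ, hδ, C, hC, hCX, h1⟩
    exact ⟨δ, hδ, C, hC, hCX, fun x hx => h1 x (hst hx)⟩
  · rintro s t ⟨δ, hδ, C, hC, hCX, h1⟩ ⟨δ', hδ', C', hC', hCX', h1'⟩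
    refine ⟨min δ δ', lt_min hδ hδ', C ∪ C', hC.union hC', union_subset hCX hCX', ?_⟩
    rintro x (hx | hx) y ⟨hy, hy'⟩
    · exact Or.inl (h1 x hx ⟨hy, Metric.ball_subset_ball (min_le_left _ _) hy'⟩)
    · exact Or.inr (h1' x hx ⟨hy, Metric.ball_subset_ball (min_le_right _ _) hy'⟩)
  · intro p hp
    obtain ⟨r, hr, C, hC, hCX, h1⟩ := h p (hKX hp)
    -- Balls of radius `r / 2` centred within `r / 2` of `p` stay in the ball of radius `r`.
    refine ⟨Metric.ball p (r / 2), mem_nhdsWithin_of_mem_nhds (Metric.ball_mem_nhds p (by linarith)),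
      r / 2, by linarith, C, hC, hCX, fun x hx y hy => h1 ⟨hy.1, ?_⟩⟩
    have h2 := hy.2
    rw [Metric.mem_ball] at *
    linarith [dist_triangle y x p]

namespace SubmanifoldAtlas

variable {N n : ℕ} {M : Set (Euc N)} {Λ : Type*} (A : SubmanifoldAtlas M n Λ)

/-- The image of a chart. -/
def codom (a : Λ) : Set (Euc n) := A.chart a '' A.dom a

theorem codom_open (a : Λ) : IsOpen (A.codom a) := A.image_open a

variable {A}

theorem dom_subset {a : Λ} : A.dom a ⊆ M :=
  (subset_iUnion A.dom a).trans A.cover.subset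

theorem chart_mem {a : Λ} {p : Euc N} (hp : p ∈ A.dom a) : A.chart a p ∈ A.codom a :=
  mem_image_of_mem _ hp

theorem param_mem {a : Λ} {y : Euc n} (hy : y ∈ A.codom a) : A.param a y ∈ A.dom a := by
  obtain ⟨p, hp, rfl⟩ := hy
  rwa [A.left_inv a p hp]

theorem chart_param {a : Λ} {y : Euc n} (hy : y ∈ A.codom a) : A.chart a (A.param a y) = y := by
  obtain ⟨p, hp, rfl⟩ := hy
  rw [A.left_inv a p hp]

theorem exists_dom {p : Euc N} (hp : p ∈ M) : ∃ a, p ∈ A.dom a := by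
  rw [← A.cover] at hp
  exact mem_iUnion.1 hp

/-- The compact set is the parametrized image of a closed coordinate ball; it contains a
neighbourhood of `p` in `M` since the chart is continuous and its domain relatively open. -/
theorem exists_ball_subset_dom {a : Λ} {p : Euc N} (hp : p ∈ A.dom a) :
    ∃ r > 0, ∃ C, IsCompact C ∧ C ⊆ A.dom a ∧ M ∩ Metric.ball p r ⊆ C := by
  obtain ⟨ρ, hρ, hball⟩ :=
    Metric.nhds_basis_closedBall.mem_iff.1 ((A.codom_open a).mem_nhds (chart_mem hp))
  have h1 : A.chart a ⁻¹' Metric.ball (A.chart a p) ρ ∈ 𝓝[A.dom a] p :=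
    (A.chart_continuousOn a p hp) (Metric.ball_mem_nhds _ hρ)
  obtain ⟨r, hr, hr1⟩ := Metric.mem_nhdsWithin_iff.1 h1
  obtain ⟨O, hO, hdom⟩ := A.dom_open a
  obtain ⟨s, hs, hs1⟩ := Metric.isOpen_iff.1 hO p (hdom ▸ hp).2
  refine ⟨min r s, lt_min hr hs, A.param a '' Metric.closedBall (A.chart a p) ρ,
    (isCompact_closedBall _ _).image_of_continuousOn
      ((A.param_contDiffOn a).continuousOn.mono hball), ?_, ?_⟩
  · rintro _ ⟨y, hy, rfl⟩
    exact param_mem (hball hy)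
  · rintro q ⟨hq, hqb⟩
    have hqd : q ∈ A.dom a := by
      rw [hdom]
      exact ⟨hq, hs1 (Metric.ball_subset_ball (min_le_right _ _) hqb)⟩
    exact ⟨A.chart a q, Metric.ball_subset_closedBall
      (hr1 ⟨Metric.ball_subset_ball (min_le_left _ _) hqb, hqd⟩), A.left_inv a q hqd⟩

theorem exists_compact_dom {a : Λ} {K : Set (Euc N)} (hK : IsCompact K) (hKd : K ⊆ A.dom a) :
    ∃ δ > 0, ∃ C, IsCompact C ∧ C ⊆ A.dom a ∧ ∀ x ∈ K, M ∩ Metric.ball x δ ⊆ C :=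
  exists_compact_of_locally (fun _ hp => exists_ball_subset_dom hp) hK hKd

variable (A) in
include A in
theorem exists_compact {K : Set (Euc N)} (hK : IsCompact K) (hKM : K ⊆ M) :
    ∃ δ > 0, ∃ C, IsCompact C ∧ C ⊆ M ∧ ∀ x ∈ K, M ∩ Metric.ball x δ ⊆ C := by
  refine exists_compact_of_locally (fun p hp => ?_) hK hKM
  obtain ⟨a, ha⟩ := A.exists_dom hp
  obtain ⟨r, hr, C, hC, hCd, h⟩ := exists_ball_subset_dom ha
  exact ⟨r, hr, C, hC, hCd.trans dom_subset, h⟩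

/-- The image of a chart contains the balls that cannot leave the chart domain: a boundary point
of the image would give a point of `M` outside the domain. -/
theorem ball_subset_codom {a : Λ} {L : NNReal}
    (hL : LipschitzOnWith L (A.param a) (A.codom a)) {C : Set (Euc N)} (hC : IsCompact C)
    (hCM : C ⊆ M) {x : Euc N} {ρ s : ℝ} (hx : x ∈ A.dom a) (hs : L * s < ρ)
    (hρC : M ∩ Metric.ball x ρ ⊆ C) (hρ : M ∩ Metric.ball x ρ ⊆ A.dom a) :
    Metric.ball (A.chart a x) s ⊆ A.codom a := by
  rcases le_or_gt s 0 with h0 | h0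
  · rw [Metric.ball_eq_empty.2 h0]; exact empty_subset _
  -- The ball is connected and the image of the chart is open, so it suffices that the image is also
  -- closed relative to the ball.
  refine (convex_ball _ s).isPreconnected.subset_of_closure_inter_subset (A.codom_open a)
    ⟨_, Metric.mem_ball_self h0, chart_mem hx⟩ ?_
  rintro w ⟨hw, hws⟩
  obtain ⟨u, hu, hlim⟩ := mem_closure_iff_seq_limit.1 hw
  have hball : ∀ᶠ j in atTop, u j ∈ Metric.ball (A.chart a x) s :=
    hlim (Metric.isOpen_ball.mem_nhds hws)
  have hdist : ∀ᶠ j in atTop, dist (A.param a (u j)) x ≤ L * s := by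
    filter_upwards [hball] with j hj
    have h1 := hL.dist_le_mul _ (hu j) _ (chart_mem hx)
    rw [A.left_inv a x hx] at h1
    exact h1.trans (mul_le_mul_of_nonneg_left (Metric.mem_ball.1 hj).le L.2)
  have hmem : ∀ᶠ j in atTop, A.param a (u j) ∈ C := by
    filter_upwards [hdist] with j hj
    exact hρC ⟨dom_subset (param_mem (hu j)), hj.trans_lt hs⟩
  -- The points of `M` over a sequence tending to `w` accumulate in `C`, at a point `q` still in the
  -- domain because `L * s < ρ`; continuity of the chart at `q` then identifies `w` with its image.
  obtain ⟨q, hq, φ, hφ, hqlim⟩ := hC.tendsto_subseq' hmem.frequently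
  have hqd : q ∈ A.dom a := by
    refine hρ ⟨hCM hq, lt_of_le_of_lt (le_of_tendsto (hqlim.dist tendsto_const_nhds) ?_) hs⟩
    exact hφ.tendsto_atTop.eventually hdist
  have h2 : Tendsto (fun j => A.chart a (A.param a (u (φ j)))) atTop (𝓝 (A.chart a q)) :=
    (A.chart_continuousOn a q hqd).tendsto.comp (tendsto_nhdsWithin_iff.2
      ⟨hqlim, Eventually.of_forall fun j => param_mem (hu _)⟩)
  simp only [chart_param (hu _)] at h2
  rw [tendsto_nhds_unique (hlim.comp hφ.tendsto_atTop) h2]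
  exact chart_mem hqd

/-! ### Changes of charts -/

variable (A) in
/-- The domain of the change of charts `φ_b ∘ φ_a⁻¹`. -/
def overlap (a b : Λ) : Set (Euc n) := A.codom a ∩ A.param a ⁻¹' A.dom b

theorem overlap_open (a b : Λ) : IsOpen (A.overlap a b) := by
  obtain ⟨O, hO, hdom⟩ := A.dom_open b
  have h : A.overlap a b = A.codom a ∩ A.param a ⁻¹' O := by
    ext y
    simp only [overlap, mem_inter_iff, mem_preimage, hdom]
    exact ⟨fun h => ⟨h.1, h.2.2⟩, fun h => ⟨h.1, dom_subset (param_mem h.1), h.2⟩⟩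
  rw [h]
  exact (A.param_contDiffOn a).continuousOn.isOpen_inter_preimage (A.codom_open a) hO

theorem param_contDiffAt {a : Λ} {y : Euc n} (hy : y ∈ A.codom a) :
    ContDiffAt ℝ ∞ (A.param a) y :=
  (A.param_contDiffOn a).contDiffAt ((A.codom_open a).mem_nhds hy)

/-- An immersive parametrization has locally a smooth left inverse on the ambient space. -/
theorem exists_local_left_inverse {a : Λ} {y : Euc n} (hy : y ∈ A.codom a) :
    ∃ g : Euc N → Euc n, ContDiffAt ℝ ∞ g (A.param a y) ∧
      ∀ᶠ z in 𝓝 y, g (A.param a z) = z := by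
  have hd := param_contDiffAt hy
  set T := fderiv ℝ (A.param a) y with hT
  have hinj : LinearMap.ker (T : Euc n →ₗ[ℝ] Euc N) = ⊥ :=
    LinearMap.ker_eq_bot.2 (A.param_immersion a y hy)
  -- Composing the parametrization with a linear left inverse `P` of its derivative gives derivative
  -- identity at `y`; the inverse function theorem applies, and `g` is the local inverse after `P`.
  obtain ⟨P₀, hP₀⟩ := LinearMap.exists_leftInverse_of_injective _ hinj
  set P : Euc N →L[ℝ] Euc n := LinearMap.toContinuousLinearMap P₀ with hP
  have hPT : P ∘L T = ((ContinuousLinearEquiv.refl ℝ (Euc n) : Euc n ≃L[ℝ] Euc n) :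
      Euc n →L[ℝ] Euc n) := by
    refine ContinuousLinearMap.ext fun v => ?_
    exact LinearMap.congr_fun hP₀ v
  have hf : ContDiffAt ℝ ∞ (fun z => P (A.param a z)) y := P.contDiff.contDiffAt.comp y hd
  have hf' : HasFDerivAt (fun z => P (A.param a z))
      ((ContinuousLinearEquiv.refl ℝ (Euc n) : Euc n ≃L[ℝ] Euc n) : Euc n →L[ℝ] Euc n) y := by
    rw [← hPT]
    exact P.hasFDerivAt.comp y (hd.differentiableAt (by simp)).hasFDerivAt
  refine ⟨hf.localInverse hf' (by simp) ∘ P, ?_, ?_⟩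
  · refine ContDiffAt.comp _ ?_ P.contDiff.contDiffAt
    exact hf.to_localInverse hf' (by simp)
  · exact (hf.hasStrictFDerivAt' hf' (by simp)).eventually_left_inverse

variable (A) in
/-- The change of charts `φ_b ∘ φ_a⁻¹`. -/
def change (a b : Λ) : Euc n → Euc n := A.chart b ∘ A.param a

theorem change_mem {a b : Λ} {y : Euc n} (hy : y ∈ A.overlap a b) :
    A.change a b y ∈ A.codom b := chart_mem hy.2

theorem param_change {a b : Λ} {y : Euc n} (hy : y ∈ A.overlap a b) :
    A.param b (A.change a b y) = A.param a y := A.left_inv b _ hy.2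

theorem change_continuousOn (a b : Λ) : ContinuousOn (A.change a b) (A.overlap a b) :=
  (A.chart_continuousOn b).comp ((A.param_contDiffOn a).continuousOn.mono inter_subset_left)
    fun _ hy => hy.2

/-- Charts are only assumed continuous. With `g` a smooth local left inverse of `param b`, the
change of charts equals `g ∘ param a` near `y`; continuity serves to keep its values where `g`
inverts. -/
theorem change_contDiffOn (a b : Λ) : ContDiffOn ℝ ∞ (A.change a b) (A.overlap a b) := by
  intro y hy
  refine ContDiffAt.contDiffWithinAt ?_
  obtain ⟨g, hg, hgl⟩ := exists_local_left_inverse (change_mem hy)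
  rw [param_change hy] at hg
  refine (hg.comp y (param_contDiffAt hy.1)).congr_of_eventuallyEq ?_
  have h1 := ((change_continuousOn a b).continuousAt ((overlap_open a b).mem_nhds hy)).eventually hgl
  filter_upwards [h1, (overlap_open a b).mem_nhds hy] with z hz hzo
  rw [param_change hzo] at hz
  exact hz.symm

end SubmanifoldAtlas

/-! ### Left inverses of injective linear maps -/

section LeftInverse

variable {N n : ℕ}

/-- The adjoint as a continuous linear map. -/
noncomputable def adjointCLM : (Euc n →L[ℝ] Euc N) →L[ℝ] (Euc N →L[ℝ] Euc n) :=
  LinearMap.mkContinuous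
    { toFun := fun T => ContinuousLinearMap.adjoint T
      map_add' := fun S T => map_add _ S T
      map_smul' := fun c T => by simp } 1 (fun T => by simp)

/-- The left inverse `(T* T)⁻¹ T*` of an injective linear map `T`. -/
noncomputable def leftInv (T : Euc n →L[ℝ] Euc N) : Euc N →L[ℝ] Euc n :=
  (ContinuousLinearMap.inverse (adjointCLM T ∘L T)) ∘L adjointCLM T

/-- `T* T v = 0` forces `‖T v‖² = 0`; so `ContinuousLinearMap.inverse` is a genuine inverse here. -/
theorem exists_equiv_gram {T : Euc n →L[ℝ] Euc N} (hT : Function.Injective T) :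
    ∃ e : Euc n ≃L[ℝ] Euc n, (e : Euc n →L[ℝ] Euc n) = adjointCLM T ∘L T := by
  have hinj : Function.Injective (adjointCLM T ∘L T : Euc n →ₗ[ℝ] Euc n) := by
    rw [injective_iff_map_eq_zero]
    intro v hv
    have h1 : ContinuousLinearMap.adjoint T (T v) = 0 := hv
    have h2 : inner ℝ (T v) (T v) = (0 : ℝ) := by
      rw [← ContinuousLinearMap.adjoint_inner_left, h1, inner_zero_left]
    exact (map_eq_zero_iff T hT).1 (inner_self_eq_zero.1 h2)
  refine ⟨(LinearEquiv.ofInjectiveEndo _ hinj).toContinuousLinearEquiv, ?_⟩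
  ext v
  rfl

theorem leftInv_comp {T : Euc n →L[ℝ] Euc N} (hT : Function.Injective T) :
    leftInv T ∘L T = ContinuousLinearMap.id ℝ (Euc n) := by
  obtain ⟨e, he⟩ := exists_equiv_gram hT
  rw [leftInv, ContinuousLinearMap.comp_assoc, ← he, ContinuousLinearMap.inverse_equiv]
  ext v
  simp

/-- The purpose of the explicit formula: it depends smoothly on `T`, as inversion is smooth at
invertible operators. -/
theorem contDiffAt_leftInv {T : Euc n →L[ℝ] Euc N} (hT : Function.Injective T) :
    ContDiffAt ℝ ∞ (leftInv : (Euc n →L[ℝ] Euc N) → _) T := by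
  obtain ⟨e, he⟩ := exists_equiv_gram hT
  have h1 : ContDiffAt ℝ ∞ (fun T : Euc n →L[ℝ] Euc N => adjointCLM T) T :=
    adjointCLM.contDiff.contDiffAt
  refine ContDiffAt.clm_comp ?_ h1
  have h2 : ContDiffAt ℝ ∞ (fun T : Euc n →L[ℝ] Euc N => adjointCLM T ∘L T) T :=
    h1.clm_comp contDiffAt_id
  refine ContDiffAt.comp (g := ContinuousLinearMap.inverse) T ?_ h2
  simp only [← he]
  exact contDiffAt_map_inverse e

/-- The linear maps bounded by `C`, and bounded below by `1 / L`. -/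
def boundedBelow (N n : ℕ) (C L : ℝ) : Set (Euc n →L[ℝ] Euc N) :=
  {T | ‖T‖ ≤ C ∧ ∀ v, ‖v‖ ≤ L * ‖T v‖}

/-- The space of linear maps is finite-dimensional, and the lower bound is a closed condition that
keeps limits injective. -/
theorem isCompact_boundedBelow (C L : ℝ) : IsCompact (boundedBelow N n C L) := by
  refine Metric.isCompact_of_isClosed_isBounded ?_ ?_
  · have h1 : boundedBelow N n C L = {T | ‖T‖ ≤ C} ∩ ⋂ v, {T | ‖v‖ ≤ L * ‖T v‖} := by
      ext T; simp [boundedBelow]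
    rw [h1]
    refine (isClosed_le continuous_norm continuous_const).inter (isClosed_iInter fun v => ?_)
    exact isClosed_le continuous_const (by fun_prop)
  · exact (Metric.isBounded_closedBall (x := 0) (r := C)).subset fun T hT => by simpa using hT.1

theorem injective_of_mem_boundedBelow {C L : ℝ} {T : Euc n →L[ℝ] Euc N}
    (hT : T ∈ boundedBelow N n C L) : Function.Injective T := by
  rw [injective_iff_map_eq_zero]
  intro v hv
  have := hT.2 v
  rw [hv, norm_zero, mul_zero] at this
  exact norm_le_zero_iff.1 this

end LeftInverse

/-! ### Bounds of derivatives -/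

section Bounds

variable {E F G : Type*} [NormedAddCommGroup E] [NormedSpace ℝ E] [NormedAddCommGroup F]
  [NormedSpace ℝ F] [NormedAddCommGroup G] [NormedSpace ℝ G]

/-- The derivatives of `f` up to order `k` are bounded on `S`. -/
def DerivBdd (k : ℕ) (f : E → F) (S : Set E) : Prop :=
  ∃ C, ∀ i ≤ k, ∀ z ∈ S, ‖iteratedFDeriv ℝ i f z‖ ≤ C

theorem derivBdd_iff {k : ℕ} {f : E → F} {S : Set E} :
    DerivBdd k f S ↔ ∀ i ≤ k, ∃ C, ∀ z ∈ S, ‖iteratedFDeriv ℝ i f z‖ ≤ C := by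
  constructor
  · rintro ⟨C, hC⟩ i hi
    exact ⟨C, hC i hi⟩
  · intro h
    choose! C hC using h
    refine ⟨∑ i ∈ Finset.range (k + 1), |C i|, fun i hi z hz => (hC i hi z hz).trans ?_⟩
    exact (le_abs_self _).trans (Finset.single_le_sum (f := fun i => |C i|)
      (fun _ _ => abs_nonneg _) (Finset.mem_range.2 (by omega)))

theorem DerivBdd.mono {k l : ℕ} {f : E → F} {S T : Set E} (h : DerivBdd k f S) (hl : l ≤ k)
    (hT : T ⊆ S) : DerivBdd l f T := by
  obtain ⟨C, hC⟩ := h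
  exact ⟨C, fun i hi z hz => hC i (hi.trans hl) z (hT hz)⟩

theorem DerivBdd.congr {k : ℕ} {f g : E → F} {S U : Set E} (h : DerivBdd k f S) (hU : IsOpen U)
    (hSU : S ⊆ U) (hfg : EqOn g f U) : DerivBdd k g S := by
  obtain ⟨C, hC⟩ := h
  refine ⟨C, fun i hi z hz => ?_⟩
  have h1 : g =ᶠ[𝓝 z] f := hfg.eventuallyEq_of_mem (hU.mem_nhds (hSU hz))
  rw [(Filter.EventuallyEq.iteratedFDeriv ℝ h1 i).eq_of_nhds]
  exact hC i hi z hz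

theorem derivBdd_of_isCompact {f : E → F} {S U : Set E} (hU : IsOpen U) (hf : ContDiffOn ℝ ∞ f U)
    (hS : IsCompact S) (hSU : S ⊆ U) (k : ℕ) : DerivBdd k f S := by
  refine derivBdd_iff.2 fun i _ => ?_
  have h1 : ContinuousOn (iteratedFDeriv ℝ i f) S := by
    intro z hz
    refine ContinuousAt.continuousWithinAt ?_
    exact (hf.contDiffAt (hU.mem_nhds (hSU hz))).continuousAt_iteratedFDeriv (by exact_mod_cast le_top)
  obtain ⟨C, hC⟩ := hS.exists_bound_of_continuousOn h1
  exact ⟨C, hC⟩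

theorem DerivBdd.fderiv {k : ℕ} {f : E → F} {S : Set E} (h : DerivBdd (k + 1) f S) :
    DerivBdd k (fderiv ℝ f) S := by
  obtain ⟨C, hC⟩ := h
  refine ⟨C, fun i hi z hz => ?_⟩
  rw [norm_iteratedFDeriv_fderiv]
  exact hC (i + 1) (by omega) z hz

theorem DerivBdd.succ {k : ℕ} {f : E → F} {S : Set E} (h0 : DerivBdd 0 f S)
    (h : DerivBdd k (_root_.fderiv ℝ f) S) : DerivBdd (k + 1) f S := by
  refine derivBdd_iff.2 fun i hi => ?_
  rcases i with _ | i
  · exact derivBdd_iff.1 h0 0 le_rfl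
  · obtain ⟨C, hC⟩ := h
    refine ⟨C, fun z hz => ?_⟩
    rw [← norm_iteratedFDeriv_fderiv]
    exact hC i (by omega) z hz

theorem DerivBdd.comp {k : ℕ} {g : F → G} {f : E → F} {S U : Set E} {T V : Set F}
    (hU : IsOpen U) (hV : IsOpen V) (hSU : S ⊆ U) (hUV : MapsTo f U V) (hST : MapsTo f S T)
    (hg : ContDiffOn ℝ ∞ g V) (hf : ContDiffOn ℝ ∞ f U) (hgb : DerivBdd k g T)
    (hfb : DerivBdd k f S) : DerivBdd k (g ∘ f) S := by
  obtain ⟨C, hC⟩ := hgb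
  obtain ⟨D, hD⟩ := hfb
  -- The estimate for a composition needs the `j`-th derivative of `f` bounded by the `j`-th power
  -- of a constant; `max 1 D` is such a constant for all `j ≥ 1`.
  refine derivBdd_iff.2 fun i hi => ⟨i.factorial * C * (max 1 D) ^ i, fun z hz => ?_⟩
  rw [← iteratedFDerivWithin_of_isOpen i hU (hSU hz)]
  refine norm_iteratedFDerivWithin_comp_le hg hf (N := ∞) (by exact_mod_cast le_top)
    hV.uniqueDiffOn hU.uniqueDiffOn hUV (hSU hz) (fun j hj => ?_) fun j hj1 hj => ?_
  · rw [iteratedFDerivWithin_of_isOpen j hV (hUV (hSU hz))]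
    exact hC j (hj.trans hi) _ (hST hz)
  · rw [iteratedFDerivWithin_of_isOpen j hU (hSU hz)]
    refine (hD j (hj.trans hi) z hz).trans ((le_max_right 1 D).trans ?_)
    exact le_self_pow₀ (le_max_left 1 D) (by omega)

set_option maxSynthPendingDepth 5 in
theorem DerivBdd.clm_comp {k : ℕ} {g : E → F →L[ℝ] G} {H : Type*} [NormedAddCommGroup H]
    [NormedSpace ℝ H] {f : E → H →L[ℝ] F} {S U : Set E} (hU : IsOpen U) (hSU : S ⊆ U)
    (hg : ContDiffOn ℝ ∞ g U) (hf : ContDiffOn ℝ ∞ f U) (hgb : DerivBdd k g S)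
    (hfb : DerivBdd k f S) : DerivBdd k (fun z => g z ∘L f z) S := by
  obtain ⟨C, hC⟩ := hgb
  obtain ⟨D, hD⟩ := hfb
  refine derivBdd_iff.2 fun i hi => ⟨‖ContinuousLinearMap.compL ℝ H F G‖ *
    ∑ j ∈ Finset.range (i + 1), (i.choose j : ℝ) * C * D, fun z hz => ?_⟩
  rw [← iteratedFDerivWithin_of_isOpen i hU (hSU hz)]
  refine ((ContinuousLinearMap.compL ℝ H F G).norm_iteratedFDerivWithin_le_of_bilinear hg hf
    hU.uniqueDiffOn (hSU hz) (N := ∞) (n := i) (by exact_mod_cast le_top)).trans ?_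
  have hC0 : 0 ≤ C := (norm_nonneg _).trans (hC 0 (Nat.zero_le _) z hz)
  refine mul_le_mul_of_nonneg_left (Finset.sum_le_sum fun j hj => ?_) (norm_nonneg _)
  have hj' := Finset.mem_range.1 hj
  rw [iteratedFDerivWithin_of_isOpen _ hU (hSU hz), iteratedFDerivWithin_of_isOpen _ hU (hSU hz)]
  have h1 := hC j (by omega) z hz
  have h2 := hD (i - j) (by omega) z hz
  gcongr

end Bounds

namespace SubmanifoldAtlas

variable {N n : ℕ} {M : Set (Euc N)} {Λ : Type*} {A : SubmanifoldAtlas M n Λ}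

/-- The Lipschitz inequality of the chart between the points over `y + t v` and `y`, divided by `t`,
passes to the limit `t → 0⁺`. -/
theorem norm_le_fderiv_param {a : Λ} {L : NNReal} (hL : LipschitzOnWith L (A.chart a) (A.dom a))
    {y : Euc n} (hy : y ∈ A.codom a) (v : Euc n) : ‖v‖ ≤ L * ‖fderiv ℝ (A.param a) y v‖ := by
  have hd : HasFDerivAt (A.param a) (fderiv ℝ (A.param a) y) y :=
    ((param_contDiffAt hy).differentiableAt (by simp)).hasFDerivAt
  have h1 := (hd.hasLineDerivAt v).tendsto_slope_zero_right
  refine ge_of_tendsto (h1.norm.const_mul (L : ℝ)) ?_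
  have hc : ContinuousAt (fun t : ℝ => y + t • v) 0 := by fun_prop
  have h2 : ∀ᶠ t : ℝ in 𝓝[>] 0, y + t • v ∈ A.codom a :=
    (hc.eventually (by simpa using (A.codom_open a).mem_nhds hy)).filter_mono nhdsWithin_le_nhds
  filter_upwards [h2, self_mem_nhdsWithin] with t ht ht0
  have ht0 : 0 < t := ht0
  have h3 := hL.norm_sub_le (param_mem ht) (param_mem hy)
  rw [chart_param ht, chart_param hy, add_sub_cancel_left, norm_smul, Real.norm_of_nonneg ht0.le]
    at h3
  rw [norm_smul, norm_inv, Real.norm_of_nonneg ht0.le, mul_left_comm, ← div_eq_inv_mul,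
    le_div_iff₀ ht0, mul_comm]
  exact h3

variable (A) in
/-- The derivatives of all orders of the parametrization `φ_a⁻¹` are bounded over `K`. -/
def BddOver (a : Λ) (K : Set (Euc N)) : Prop :=
  ∀ k : ℕ, DerivBdd k (A.param a) {y ∈ A.codom a | A.param a y ∈ K}

theorem bddOver_of_isCompact {a : Λ} {K : Set (Euc N)} (hK : IsCompact K) (hKd : K ⊆ A.dom a) :
    A.BddOver a K := by
  intro k
  refine (derivBdd_of_isCompact (A.codom_open a) (A.param_contDiffOn a)
    (hK.image_of_continuousOn ((A.chart_continuousOn a).mono hKd)) ?_ k).mono le_rfl ?_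
  · rintro _ ⟨p, hp, rfl⟩
    exact chart_mem (hKd hp)
  · rintro y ⟨hy, hyK⟩
    exact ⟨_, hyK, chart_param hy⟩

/-- The derivatives of the changes of charts are bounded where those of the two parametrizations
are. -/
theorem change_derivBdd {a b : Λ} {L : NNReal} (hL : LipschitzOnWith L (A.chart b) (A.dom b))
    {K K' : Set (Euc N)} (ha : A.BddOver a K) (hb : A.BddOver b K') (k : ℕ) :
    DerivBdd k (A.change a b) {y ∈ A.overlap a b | A.param a y ∈ K ∩ K'} := by
  set S := {y ∈ A.overlap a b | A.param a y ∈ K ∩ K'} with hS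
  have hSU : S ⊆ A.overlap a b := fun y hy => hy.1
  have hU : IsOpen (A.overlap a b) := overlap_open a b
  have h0 : DerivBdd 0 (A.change a b) S := by
    obtain ⟨C, hC⟩ := ha 0
    obtain ⟨p, hp⟩ := A.dom_nonempty b
    refine ⟨L * (C + ‖p‖) + ‖A.chart b p‖, fun i hi y hy => ?_⟩
    obtain rfl : i = 0 := by omega
    rw [norm_iteratedFDeriv_zero]
    have h1 := hC 0 le_rfl y ⟨hy.1.1, hy.2.1⟩
    rw [norm_iteratedFDeriv_zero] at h1
    have h2 := hL.norm_sub_le hy.1.2 hp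
    have h3 : ‖A.change a b y‖ ≤ ‖A.chart b (A.param a y) - A.chart b p‖ + ‖A.chart b p‖ := by
      simpa [change] using norm_add_le (A.chart b (A.param a y) - A.chart b p) (A.chart b p)
    have h4 := norm_sub_le (A.param a y) p
    have h5 : (L : ℝ) * ‖A.param a y - p‖ ≤ L * (C + ‖p‖) :=
      mul_le_mul_of_nonneg_left (by linarith) L.2
    linarith
  obtain ⟨D, hD⟩ := (hb 1)
  have hcb : ContDiffOn ℝ ∞ (fderiv ℝ (A.param b)) (A.codom b) :=
    (A.param_contDiffOn b).fderiv_of_isOpen (A.codom_open b) (by simp)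
  have hca : ContDiffOn ℝ ∞ (fderiv ℝ (A.param a)) (A.overlap a b) :=
    ((A.param_contDiffOn a).fderiv_of_isOpen (A.codom_open a) (by simp)).mono inter_subset_left
  -- Differentiate `param b ∘ change a b = param a` and cancel the injective derivative of `param
  -- b`.
  have hformula : EqOn (fderiv ℝ (A.change a b)) (fun y =>
      leftInv (fderiv ℝ (A.param b) (A.change a b y)) ∘L fderiv ℝ (A.param a) y)
      (A.overlap a b) := by
    intro y hy
    have h1 : fderiv ℝ (A.param b ∘ A.change a b) y = fderiv ℝ (A.param a) y := by
      refine Filter.EventuallyEq.fderiv_eq ?_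
      filter_upwards [hU.mem_nhds hy] with z hz using param_change hz
    rw [fderiv_comp y ((param_contDiffAt (change_mem hy)).differentiableAt (by simp))
      (((change_contDiffOn a b).contDiffAt (hU.mem_nhds hy)).differentiableAt (by simp))] at h1
    simp only
    rw [← h1, ← ContinuousLinearMap.comp_assoc,
      leftInv_comp (A.param_immersion b _ (change_mem hy)), ContinuousLinearMap.id_comp]
  have hmaps : MapsTo (A.change a b) S {y ∈ A.codom b | A.param b y ∈ K'} := fun y hy =>
    ⟨change_mem hy.1, by rw [param_change hy.1]; exact hy.2.2⟩
  have hcD : ContDiffOn ℝ ∞ (fderiv ℝ (A.param b) ∘ A.change a b) (A.overlap a b) :=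
    hcb.comp (change_contDiffOn a b) fun y hy => change_mem hy
  have hinj : MapsTo (fderiv ℝ (A.param b) ∘ A.change a b) (A.overlap a b)
      {T | Function.Injective T} := fun y hy => A.param_immersion b _ (change_mem hy)
  have hcl : ContDiffOn ℝ ∞ (leftInv : (Euc n →L[ℝ] Euc N) → _) {T | Function.Injective T} :=
    fun T hT => (contDiffAt_leftInv hT).contDiffWithinAt
  -- On this compact set of injective maps all derivatives of `leftInv` are bounded.
  have hmem : MapsTo (fderiv ℝ (A.param b) ∘ A.change a b) S (boundedBelow N n D L) := by
    intro y hy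
    refine ⟨?_, norm_le_fderiv_param hL (change_mem hy.1)⟩
    have := hD 1 le_rfl _ (hmaps hy)
    rwa [norm_iteratedFDeriv_one] at this
  -- The right side of the formula involves the change of charts itself but not its derivative, so
  -- bounds up to order `k` yield those of order `k + 1`.
  induction k with
  | zero => exact h0
  | succ k ih =>
    refine h0.succ (DerivBdd.congr ?_ hU hSU hformula)
    refine DerivBdd.clm_comp hU hSU (hcl.comp hcD hinj) hca ?_ ?_
    · refine DerivBdd.comp (g := leftInv) hU ContinuousLinearMap.isOpen_injective hSU hinj hmem hcl hcD
        (derivBdd_of_isCompact ContinuousLinearMap.isOpen_injective hcl (isCompact_boundedBelow D L)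
          (fun T hT => injective_of_mem_boundedBelow hT) k) ?_
      exact DerivBdd.comp hU (A.codom_open b) hSU (fun y hy => change_mem hy) hmaps hcb
        (change_contDiffOn a b) (hb (k + 1)).fderiv ih
    · exact (ha (k + 1)).fderiv.mono le_rfl fun y hy => ⟨hy.1.1, hy.2.1⟩

end SubmanifoldAtlas

/-! ### Injectivity of the derivative of an isometry -/

theorem isModerate_rpow (s : ℝ) : IsModerate fun ε => (ε : ℝ) ^ s := by
  refine ⟨s - 1, ?_⟩
  show ∀ᶠ ε : Idx in small, |(ε : ℝ) ^ s| < (ε : ℝ) ^ (s - 1)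
  filter_upwards [eventually_const_mul_rpow_lt 1 (show s - 1 < s by linarith)] with ε hε
  rwa [abs_of_pos (Real.rpow_pos_of_pos ε.2.1 s), ← one_mul ((ε : ℝ) ^ s)]

theorem norm_gReal_mul_le (a b : GReal) : ‖a * b‖ ≤ ‖a‖ * ‖b‖ := by
  obtain ⟨x, rfl⟩ := GReal.mk_surjective a
  obtain ⟨y, rfl⟩ := GReal.mk_surjective b
  have h := netNorm_mul_le x.2 y.2
  rw [← map_mul]
  show sharpNorm _ ≤ sharpNorm _ * sharpNorm _
  rw [sharpNorm_mk, sharpNorm_mk, sharpNorm_mk]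
  exact h

/-- Nonzero real scalars have sharp norm 1 and do not shrink vectors; the class of a high power of
`ε` does, and it is invertible. The exponent is `s + 1` because orders are defined by a strict
inequality. -/
theorem exists_unit_smul_norm_lt {n : ℕ} (v : GVec n) {c : ℝ} (hc : 0 < c) :
    ∃ t u : GReal, u * t = 1 ∧ ‖t • v‖ < c := by
  have h1 : Tendsto (fun s : ℝ => Real.exp (-s) * ‖v‖) atTop (𝓝 0) := by
    simpa using (Real.tendsto_exp_neg_atTop_nhds_zero).mul_const ‖v‖
  obtain ⟨s, hs⟩ := (h1.eventually (eventually_lt_nhds hc)).exists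
  refine ⟨netClass fun ε => (ε : ℝ) ^ (s + 1), netClass fun ε => (ε : ℝ) ^ (-(s + 1)), ?_, ?_⟩
  · rw [← netClass_mul (isModerate_rpow _) (isModerate_rpow _)]
    have h2 : ((fun ε : Idx => (ε : ℝ) ^ (-(s + 1))) * fun ε : Idx => (ε : ℝ) ^ (s + 1)) = 1 := by
      ext ε
      rw [Pi.mul_apply, ← Real.rpow_add ε.2.1]
      simp
    have h3 : IsModerate (1 : Idx → ℝ) := isModerate_const 1
    rw [h2, netClass_of h3]
    exact map_one GReal.mk
  · have h4 : ‖netClass fun ε : Idx => (ε : ℝ) ^ (s + 1)‖ ≤ Real.exp (-s) := by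
      rw [norm_netClass (isModerate_rpow _)]
      refine netNorm_le ?_
      show ∀ᶠ ε : Idx in small, |(ε : ℝ) ^ (s + 1)| < (ε : ℝ) ^ s
      filter_upwards [eventually_const_mul_rpow_lt 1 (show s < s + 1 by linarith)] with ε hε
      rwa [abs_of_pos (Real.rpow_pos_of_pos ε.2.1 _), ← one_mul ((ε : ℝ) ^ (s + 1))]
    refine lt_of_le_of_lt ?_ hs
    rw [pi_norm_le_iff_of_nonneg (by positivity)]
    intro i
    rw [Pi.smul_apply, smul_eq_mul]
    exact (norm_gReal_mul_le _ _).trans (mul_le_mul h4 (norm_le_pi_norm v i) (norm_nonneg _)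
      (Real.exp_pos _).le)

/-- If `L v = 0`, a small unit multiple `t • v` satisfies `‖t • v‖ ≤ ‖F (p + t • v) - F p‖ ≤ ‖t • v‖
/ 2`; so `t • v = 0`, and `v = 0` since `t` is invertible. -/
theorem HasGDerivAt.injective {m k : ℕ} {F : GVec m → GVec k} {L : GVec m →ₗ[GReal] GVec k}
    {p : GVec m} (h : HasGDerivAt F L p) (hF : ∀ᶠ q in 𝓝 p, ‖q - p‖ ≤ ‖F q - F p‖) :
    Function.Injective L := by
  rw [injective_iff_map_eq_zero]
  intro v hv
  have h1 := (h.bound (show (0 : ℝ) < 1 / 2 by norm_num)).and hF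
  obtain ⟨ρ, hρ, hball⟩ := Metric.eventually_nhds_iff_ball.1 h1
  obtain ⟨t, u, hut, ht⟩ := exists_unit_smul_norm_lt v hρ
  obtain ⟨h2, h3⟩ := hball (p + t • v) (by simpa [mem_ball_iff_norm] using ht)
  rw [add_sub_cancel_left, map_smul, hv, smul_zero, sub_zero] at h2
  rw [add_sub_cancel_left] at h3
  have h4 : ‖t • v‖ = 0 := le_antisymm (by linarith) (norm_nonneg _)
  have h5 : u • t • v = 0 := by rw [norm_eq_zero.1 h4, smul_zero]
  rwa [smul_smul, hut, one_smul] at h5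

/-! ### The generalized charts -/

/-- Makes constants depending on the chart uniform in `ε`: only finitely many charts occur along
`l`. -/
theorem exists_uniform_of_finite_range {ι α β : Type*} [SemilatticeSup β] [Nonempty β] {l : ι → α}
    (hl : (range l).Finite) {P : α → β → Prop} (hP : ∀ a, ∀ c c', c ≤ c' → P a c → P a c')
    (h : ∀ a, ∃ c, P a c) : ∃ c, ∀ i, P (l i) c := by
  choose c hc using h
  obtain ⟨B, hB⟩ := (hl.image c).bddAbove
  exact ⟨B, fun i => hP _ _ _ (hB (mem_image_of_mem c (mem_range_self i))) (hc _)⟩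

theorem eventually_rpow_le {s t : ℝ} (h : s ≤ t) : ∀ ε : Idx, (ε : ℝ) ^ t ≤ (ε : ℝ) ^ s :=
  fun ε => Real.rpow_le_rpow_of_exponent_ge ε.2.1 ε.2.2 h

theorem exists_open_of_forall_ball {E : Type*} [NormedAddCommGroup E] {S D : Set E} (hD : D ⊆ S)
    (h : ∀ p ∈ D, ∃ r > 0, ∀ q ∈ S, ‖q - p‖ < r → q ∈ D) : ∃ O, IsOpen O ∧ D = S ∩ O := by
  choose! r hr h using h
  refine ⟨⋃ p ∈ D, Metric.ball p (r p), isOpen_biUnion fun p _ => Metric.isOpen_ball, ?_⟩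
  refine Subset.antisymm (fun p hp => ⟨hD hp, mem_iUnion₂.2
    ⟨p, hp, Metric.mem_ball_self (hr p hp)⟩⟩) ?_
  rintro q ⟨hq, hq'⟩
  obtain ⟨p, hp, hpq⟩ := mem_iUnion₂.1 hq'
  exact h p hp q hq (mem_ball_iff_norm.1 hpq)

theorem exists_rep_of_mem_tildeC {N : ℕ} {M : Set (Euc N)} {p : GVec N} (hp : p ∈ tildeC M) :
    ∃ x, Represents x p ∧ ∀ᶠ ε in small, x ε ∈ M := by
  obtain ⟨x, hx, K, -, hKM, hxK⟩ := hp
  exact ⟨x, hx, hxK.mono fun ε hε => hKM hε⟩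

namespace SubmanifoldAtlas

variable {N n : ℕ} {M : Set (Euc N)} {Λ : Type*} {A : SubmanifoldAtlas M n Λ}

variable (A) in
include A in
theorem exists_compact_of_represents {p : GVec N} (hp : p ∈ tildeC M) {x : Idx → Euc N}
    (hx : Represents x p) (hxM : ∀ᶠ ε in small, x ε ∈ M) :
    ∃ K, IsCompact K ∧ K ⊆ M ∧ ∀ᶠ ε in small, x ε ∈ K := by
  obtain ⟨y, hy, K, hK, hKM, hyK⟩ := hp
  obtain ⟨δ, hδ, C, hC, hCM, h⟩ := A.exists_compact hK hKM
  refine ⟨C, hC, hCM, ?_⟩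
  filter_upwards [hx.eventually_lt_self hy 1, hyK, hxM, eventually_small_lt hδ] with ε h1 h2 h3 h4
  rw [Real.rpow_one] at h1
  exact h _ h2 ⟨h3, mem_ball_iff_norm.2 (h1.trans h4)⟩

theorem IsLipschitz.exists_uniform (hA : A.IsLipschitz) {l : Idx → Λ} (hl : (range l).Finite) :
    ∃ L : NNReal, ∀ ε, LipschitzOnWith L (A.chart (l ε)) (A.dom (l ε)) ∧
      LipschitzOnWith L (A.param (l ε)) (A.codom (l ε)) := by
  refine exists_uniform_of_finite_range (P := fun a L => LipschitzOnWith L (A.chart a) (A.dom a) ∧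
    LipschitzOnWith L (A.param a) (A.codom a)) hl (fun a c c' hc h => ⟨h.1.weaken hc, h.2.weaken hc⟩)
    fun a => ?_
  obtain ⟨⟨L, hL⟩, L', hL'⟩ := hA a
  exact ⟨max L L', hL.weaken (le_max_left _ _), hL'.weaken (le_max_right _ _)⟩

variable {l l' : Idx → Λ} {p q : GVec N} {x y : Idx → Euc N}

theorem eventually_mem_dom (hp : p ∈ A.gDom l) (hx : Represents x p)
    (hxM : ∀ᶠ ε in small, x ε ∈ M) : ∀ᶠ ε in small, x ε ∈ A.dom (l ε) := hp.2.2 x hx hxM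

/-- The distance of a point of `U_l` to the complement of the chart domains is bounded below by a
power of `ε`. -/
theorem exists_ball_subset_dom_of_mem_gDom (hp : p ∈ A.gDom l) (hx : Represents x p) :
    ∃ m : ℕ, ∀ᶠ ε in small, M ∩ Metric.ball (x ε) ((ε : ℝ) ^ (m : ℝ)) ⊆ A.dom (l ε) := by
  classical
  by_contra! hcon
  have h1 : ∀ m : ℕ, ∃ ε : Idx, (ε : ℝ) < 1 / (m + 1) ∧ ∃ z ∈ M, z ∉ A.dom (l ε) ∧
      ‖z - x ε‖ < (ε : ℝ) ^ (m : ℝ) := by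
    intro m
    have h2 := hcon m
    obtain ⟨ε, h3, h4⟩ := (h2.and_eventually (eventually_small_lt
      (show (0 : ℝ) < 1 / (m + 1) by positivity))).exists
    rw [not_subset] at h3
    obtain ⟨z, ⟨hzM, hzb⟩, hz⟩ := h3
    exact ⟨ε, h4, z, hzM, hz, mem_ball_iff_norm.1 hzb⟩
  choose e he z hzM hz hzx using h1
  obtain ⟨x₀, hx₀, hx₀M⟩ := exists_rep_of_mem_tildeC hp.1
  -- A representative in `M` modified along `e` so as to leave the domains. The sequence `e` need
  -- not be injective, but the chosen index is harmless: by `hsmall`, every `m` with `e m = ε` is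
  -- large when `ε` is small, so the modification is negligible.
  let w : Idx → Euc N := fun ε => if h : ∃ m, e m = ε then z h.choose else x₀ ε
  have hsmall : ∀ k : ℕ, ∀ᶠ ε : Idx in small, ∀ m, e m = ε → k ≤ m := by
    intro k
    have h2 : ∀ᶠ ε : Idx in small, ∀ m ∈ Finset.range k, (ε : ℝ) < e m :=
      (eventually_all_finset _).2 fun m _ => eventually_small_lt (e m).2.1
    filter_upwards [h2] with ε hε m hm
    by_contra hlt
    have := hε m (Finset.mem_range.2 (by omega))
    rw [hm] at this
    exact lt_irrefl _ this
  have hneg : IsNegligible fun ε => ‖w ε - x ε‖ := by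
    intro k
    have h3 := isNegligible_iff.1 (hx₀.negligible hx) k
    have h3' : ∀ᶠ ε : Idx in small, |‖x₀ ε - x ε‖| < (ε : ℝ) ^ (k : ℝ) := h3
    filter_upwards [h3', hsmall k] with ε h4 h5
    by_cases h : ∃ m, e m = ε
    · have hw : w ε = z h.choose := dif_pos h
      have h6 := hzx h.choose
      rw [h.choose_spec] at h6
      rw [abs_norm, hw, ← Real.rpow_natCast]
      exact h6.trans_le (eventually_rpow_le (by exact_mod_cast h5 _ h.choose_spec) ε)
    · have hw : w ε = x₀ ε := dif_neg h
      rw [hw, ← Real.rpow_natCast]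
      exact h4
  have hwM : ∀ᶠ ε in small, w ε ∈ M := by
    filter_upwards [hx₀M] with ε hε
    by_cases h : ∃ m, e m = ε
    · have hw : w ε = z h.choose := dif_pos h
      rw [hw]; exact hzM _
    · have hw : w ε = x₀ ε := dif_neg h
      rwa [hw]
  have hlim : Tendsto e atTop small := by
    rw [small, tendsto_comap_iff]
    refine squeeze_zero (fun m => (e m).2.1.le) (fun m => (he m).le) ?_
    exact tendsto_one_div_add_atTop_nhds_zero_nat
  obtain ⟨m, hm⟩ := (hlim.eventually (hp.2.2 w (hx.of_negligible hneg) hwM)).exists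
  have h : ∃ m', e m' = e m := ⟨m, rfl⟩
  have hw : w (e m) = z h.choose := dif_pos h
  have h7 := hz h.choose
  rw [h.choose_spec] at h7
  rw [hw] at hm
  exact h7 hm

/-- A margin `ε^m` to the complement of the domains is exactly a sharp ball of radius `e^{-m}`. -/
theorem gDom_relOpen (l : Idx → Λ) : ∃ O, IsOpen O ∧ A.gDom l = tildeC M ∩ O := by
  refine exists_open_of_forall_ball inter_subset_left fun p hp => ?_
  obtain ⟨x, hx, hxM⟩ := exists_rep_of_mem_tildeC hp.1
  obtain ⟨m, hm⟩ := exists_ball_subset_dom_of_mem_gDom hp hx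
  refine ⟨Real.exp (-m), Real.exp_pos _, fun q hq hqp =>
    ⟨hq, exists_rep_of_mem_tildeC hq, fun y hy hyM => ?_⟩⟩
  filter_upwards [hm, hyM, hy.eventually_lt hx hqp] with ε h1 h2 h3
  exact h1 ⟨h2, mem_ball_iff_norm.2 h3⟩

theorem represents_chart (hA : A.IsLipschitz) (hl : (range l).Finite) (hp : p ∈ A.gDom l)
    (hx : Represents x p) (hxd : ∀ᶠ ε in small, x ε ∈ A.dom (l ε)) :
    Represents (fun ε => A.chart (l ε) (x ε)) (vecClass fun ε => A.chart (l ε) (x ε)) := by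
  obtain ⟨K, hK, -, hxK⟩ := A.exists_compact_of_represents hp.1 hx
    (hxd.mono fun ε hε => dom_subset hε)
  obtain ⟨L, hL⟩ := hA.exists_uniform hl
  choose c hc using A.dom_nonempty
  obtain ⟨B, hB⟩ := exists_uniform_of_finite_range (P := fun a B => ‖A.chart a (c a)‖ ≤ B ∧
    ‖c a‖ ≤ B) hl (fun a c c' h h' => ⟨h'.1.trans h, h'.2.trans h⟩)
    fun a => ⟨max ‖A.chart a (c a)‖ ‖c a‖, le_max_left _ _, le_max_right _ _⟩
  obtain ⟨R, hR⟩ := hK.isBounded.exists_norm_le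
  refine represents_of_bounded (C := L * (R + B) + B) ?_
  filter_upwards [hxd, hxK] with ε h1 h2
  have h3 := (hL ε).1.norm_sub_le h1 (hc (l ε))
  have h4 := norm_sub_le (x ε) (c (l ε))
  have h5 : ‖A.chart (l ε) (x ε)‖ ≤ ‖A.chart (l ε) (x ε) - A.chart (l ε) (c (l ε))‖ +
      ‖A.chart (l ε) (c (l ε))‖ := by
    simpa using norm_add_le (A.chart (l ε) (x ε) - A.chart (l ε) (c (l ε)))
      (A.chart (l ε) (c (l ε)))
  have h6 : (L : ℝ) * ‖x ε - c (l ε)‖ ≤ L * (R + B) :=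
    mul_le_mul_of_nonneg_left (by linarith [hR _ h2, (hB ε).2]) L.2
  linarith [(hB ε).1]

/-- Lipschitz charts send negligible differences to negligible ones, so the choice in `gChart` is
immaterial. -/
theorem represents_gChart (hA : A.IsLipschitz) (hl : (range l).Finite) (hp : p ∈ A.gDom l)
    (hx : Represents x p) (hxM : ∀ᶠ ε in small, x ε ∈ M) :
    Represents (fun ε => A.chart (l ε) (x ε)) (A.gChart l p) := by
  have hxd := eventually_mem_dom hp hx hxM
  have h : ∃ x, Represents x p ∧ ∀ᶠ ε in small, x ε ∈ A.dom (l ε) := ⟨x, hx, hxd⟩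
  have hdef : A.gChart l p = vecClass fun ε => A.chart (l ε) (h.choose ε) := dif_pos h
  obtain ⟨L, hL⟩ := hA.exists_uniform hl
  rw [hdef]
  refine (represents_chart hA hl hp h.choose_spec.1 h.choose_spec.2).of_negligible ?_
  refine (hx.negligible h.choose_spec.1).of_le (C := L) ?_
  filter_upwards [hxd, h.choose_spec.2] with ε h1 h2
  rw [abs_norm, abs_norm]
  exact (hL ε).1.norm_sub_le h1 h2

theorem norm_gChart_sub (hA : A.IsLipschitz) (hl : (range l).Finite) (hp : p ∈ A.gDom l)
    (hq : q ∈ A.gDom l) : ‖A.gChart l p - A.gChart l q‖ = ‖p - q‖ := by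
  obtain ⟨x, hx, hxM⟩ := exists_rep_of_mem_tildeC hp.1
  obtain ⟨y, hy, hyM⟩ := exists_rep_of_mem_tildeC hq.1
  have hx' := represents_gChart hA hl hp hx hxM
  have hy' := represents_gChart hA hl hq hy hyM
  obtain ⟨L, hL⟩ := hA.exists_uniform hl
  refine le_antisymm (hx'.norm_sub_le hy' hx hy (C := L) ?_) (hx.norm_sub_le hy hx' hy' (C := L) ?_)
  all_goals
    filter_upwards [eventually_mem_dom hp hx hxM, eventually_mem_dom hq hy hyM] with ε h1 h2
  · exact (hL ε).1.norm_sub_le h1 h2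
  · have := (hL ε).2.norm_sub_le (chart_mem h1) (chart_mem h2)
    rwa [A.left_inv _ _ h1, A.left_inv _ _ h2] at this

/-- Around the coordinates of a point of `U_l`, the parametrizations are defined on balls whose
radius is a power of `ε`. -/
theorem exists_ball_subset_codom_of_mem_gDom (hA : A.IsLipschitz) (hl : (range l).Finite)
    (hp : p ∈ A.gDom l) (hx : Represents x p) (hxM : ∀ᶠ ε in small, x ε ∈ M) (t : ℝ) :
    ∃ r : ℝ, ∃ K, IsCompact K ∧ K ⊆ M ∧ ∀ᶠ ε in small,
      ∀ w ∈ Metric.ball (A.chart (l ε) (x ε)) ((ε : ℝ) ^ r), w ∈ A.codom (l ε) ∧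
        A.param (l ε) w ∈ K ∧ ‖A.param (l ε) w - x ε‖ < (ε : ℝ) ^ t ∧
        M ∩ Metric.ball (A.param (l ε) w) ((ε : ℝ) ^ r) ⊆ A.dom (l ε) := by
  obtain ⟨m, hm⟩ := exists_ball_subset_dom_of_mem_gDom hp hx
  obtain ⟨K, hK, hKM, hxK⟩ := A.exists_compact_of_represents hp.1 hx hxM
  obtain ⟨δ, hδ, C, hC, hCM, hδC⟩ := A.exists_compact hK hKM
  obtain ⟨L, hL⟩ := hA.exists_uniform hl
  -- The radius will be `s = ε^(T+1)`, so that `(L + 1) * s < ε^T`: here `L * s` bounds the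
  -- displacement of the point over `w`, and one more `s` allows for the ball around it. The bounds
  -- on `T` give respectively the chart domain, the precision `t`, and the compact set via `ε^T ≤ ε
  -- < δ`.
  obtain ⟨T, hTm, hTt, hT1⟩ : ∃ T : ℝ, (m : ℝ) ≤ T ∧ t ≤ T ∧ 1 ≤ T :=
    ⟨max (max m t) 1, (le_max_left _ _).trans (le_max_left _ _),
      (le_max_right _ _).trans (le_max_left _ _), le_max_right _ _⟩
  refine ⟨T + 1, C, hC, hCM, ?_⟩
  filter_upwards [hm, hxK, eventually_mem_dom hp hx hxM, eventually_small_lt hδ,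
    eventually_const_mul_rpow_lt (L + 1 : ℝ) (show T < T + 1 by linarith)] with ε h1 h2 h3 h4 h5
  set s := (ε : ℝ) ^ (T + 1) with hs
  have hs0 : 0 < s := Real.rpow_pos_of_pos ε.2.1 _
  have h6 : (ε : ℝ) ^ T ≤ ε := by simpa using eventually_rpow_le hT1 ε
  have h7 : M ∩ Metric.ball (x ε) ((L + 1) * s) ⊆ C := fun z hz =>
    hδC _ h2 ⟨hz.1, Metric.ball_subset_ball (by linarith) hz.2⟩
  have h8 : M ∩ Metric.ball (x ε) ((L + 1) * s) ⊆ A.dom (l ε) := fun z hz =>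
    h1 ⟨hz.1, Metric.ball_subset_ball (h5.le.trans (eventually_rpow_le hTm ε)) hz.2⟩
  have h9 := ball_subset_codom (hL ε).2 hC hCM h3 (s := s) (ρ := (L + 1) * s) (by linarith) h7 h8
  intro w hw
  have hwc := h9 hw
  have h10 : ‖A.param (l ε) w - x ε‖ ≤ L * s := by
    have h := (hL ε).2.norm_sub_le hwc (chart_mem h3)
    rw [A.left_inv _ _ h3] at h
    exact h.trans (mul_le_mul_of_nonneg_left (mem_ball_iff_norm.1 hw).le L.2)
  refine ⟨hwc, h7 ⟨dom_subset (param_mem hwc), mem_ball_iff_norm.2 (by linarith)⟩, ?_, ?_⟩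
  · exact lt_of_lt_of_le (by linarith) (eventually_rpow_le hTt ε)
  · rintro z ⟨hzM, hz⟩
    refine h8 ⟨hzM, ?_⟩
    rw [Metric.mem_ball] at *
    rw [← dist_eq_norm] at h10
    linarith [dist_triangle z (A.param (l ε) w) (x ε)]

/-- A nearby point of `ℝ̄ⁿ` is lifted by applying the parametrizations to a representative. The lift
lies in `U_l` because each point over the ball keeps a margin `ε^r` inside the chart domain. -/
theorem gChart_image_mem_nhds (hA : A.IsLipschitz) (hl : (range l).Finite) (hp : p ∈ A.gDom l) :
    A.gChart l '' A.gDom l ∈ 𝓝 (A.gChart l p) := by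
  obtain ⟨x, hx, hxM⟩ := exists_rep_of_mem_tildeC hp.1
  obtain ⟨r, K, hK, hKM, hr⟩ := exists_ball_subset_codom_of_mem_gDom hA hl hp hx hxM 0
  filter_upwards [eventually_norm_lt_exp (p := A.gChart l p) r] with z hz
  obtain ⟨w, hw⟩ := exists_represents z
  have h1 := hw.eventually_lt (represents_gChart hA hl hp hx hxM) hz
  have hwK : ∀ᶠ ε in small, A.param (l ε) (w ε) ∈ K := by
    filter_upwards [h1, hr] with ε h2 h3 using (h3 _ (mem_ball_iff_norm.2 h2)).2.1
  obtain ⟨R, hR⟩ := hK.isBounded.exists_norm_le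
  have hy : Represents (fun ε => A.param (l ε) (w ε)) (vecClass fun ε => A.param (l ε) (w ε)) :=
    represents_of_bounded (C := R) (hwK.mono fun ε hε => hR _ hε)
  have hyM := hwK.mono fun ε hε => hKM hε
  have hq : (vecClass fun ε => A.param (l ε) (w ε)) ∈ A.gDom l := by
    refine ⟨⟨_, hy, K, hK, hKM, hwK⟩, ⟨_, hy, hyM⟩, fun y' hy' hyM' => ?_⟩
    filter_upwards [h1, hr, hyM', hy'.eventually_lt_self hy r] with ε h2 h3 h4 h5
    exact (h3 _ (mem_ball_iff_norm.2 h2)).2.2.2 ⟨h4, mem_ball_iff_norm.2 h5⟩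
  refine ⟨_, hq, ?_⟩
  rw [← hw.2]
  refine ((represents_gChart hA hl hq hy hyM).congr ?_).2.symm
  filter_upwards [h1, hr] with ε h2 h3
  exact (chart_param (h3 _ (mem_ball_iff_norm.2 h2)).1).symm

/-- The chart `φ_l` maps relatively open subsets of `U_l` onto open sets. -/
theorem isOpen_gChart_image (hA : A.IsLipschitz) (hl : (range l).Finite) {D : Set (GVec N)}
    (hD : D ⊆ A.gDom l) (hDo : ∃ O, IsOpen O ∧ D = tildeC M ∩ O) : IsOpen (A.gChart l '' D) := by
  obtain ⟨O, hO, rfl⟩ := hDo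
  rw [isOpen_iff_mem_nhds]
  rintro _ ⟨p, hp, rfl⟩
  obtain ⟨ρ, hρ, hball⟩ := Metric.isOpen_iff.1 hO p hp.2
  filter_upwards [gChart_image_mem_nhds hA hl (hD hp), Metric.ball_mem_nhds _ hρ]
  rintro _ ⟨q, hq, rfl⟩ hqb
  rw [mem_ball_iff_norm, norm_gChart_sub hA hl hq (hD hp)] at hqb
  exact ⟨q, ⟨hq.1, hball (mem_ball_iff_norm.2 hqb)⟩, rfl⟩

theorem gChart_image_subset_stronglyInternal (hA : A.IsLipschitz) (hl : (range l).Finite) :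
    A.gChart l '' A.gDom l ⊆ stronglyInternal univ fun ε => A.codom (l ε) := by
  rintro _ ⟨p, hp, rfl⟩
  obtain ⟨x, hx, hxM⟩ := exists_rep_of_mem_tildeC hp.1
  obtain ⟨r, K, hK, hKM, hr⟩ := exists_ball_subset_codom_of_mem_gDom hA hl hp hx hxM 0
  have hx' := represents_gChart hA hl hp hx hxM
  refine ⟨⟨_, hx', by simp⟩, fun w hw _ => ?_⟩
  filter_upwards [hr, hw.eventually_lt_self hx' r] with ε h1 h2
  exact (h1 _ (mem_ball_iff_norm.2 h2)).1

/-! ### The domains `U_l^c` -/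

theorem exists_compact_of_mem_gDomC (hl : (range l).Finite) (hp : p ∈ A.gDomC l) :
    ∃ x, Represents x p ∧ (∀ᶠ ε in small, x ε ∈ M) ∧ p ∈ tildeC M ∧
      ∃ C : Λ → Set (Euc N), (∀ a, IsCompact (C a) ∧ C a ⊆ A.dom a) ∧
        ∃ δ > 0, ∀ᶠ ε in small, M ∩ Metric.ball (x ε) δ ⊆ C (l ε) := by
  obtain ⟨x, hx, K, hK, hxK⟩ := hp
  choose δ hδ C hC hCd h using fun a => exists_compact_dom (hK a).1 (hK a).2
  -- A common lower bound for the radii, expressed through inverses so as to be monotone in the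
  -- constant.
  obtain ⟨B, hB⟩ := exists_uniform_of_finite_range (P := fun a B => (δ a)⁻¹ ≤ B) hl
    (fun _ _ _ h h' => h'.trans h) fun a => ⟨_, le_rfl⟩
  have hB0 : 0 < max B 1 := lt_max_of_lt_right one_pos
  refine ⟨x, hx, hxK.mono fun ε hε => dom_subset ((hK _).2 hε), ⟨x, hx, ⋃ a ∈ range l, K a,
    hl.isCompact_biUnion fun a _ => (hK a).1, iUnion₂_subset fun a _ => (hK a).2.trans dom_subset,
    hxK.mono fun ε hε => mem_iUnion₂.2 ⟨l ε, mem_range_self ε, hε⟩⟩, C,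
    fun a => ⟨hC a, hCd a⟩, (max B 1)⁻¹, inv_pos.2 hB0, ?_⟩
  filter_upwards [hxK] with ε h1
  refine (inter_subset_inter_right _ (Metric.ball_subset_ball ?_)).trans (h _ _ h1)
  exact inv_le_of_inv_le₀ (hδ _) ((hB ε).trans (le_max_left _ _))

/-- The margin is now a fixed `δ > 0`, so the sharp radius `e^{-1}` suffices: nearby representatives
are closer than `ε`, eventually less than `δ`. -/
theorem gDomC_ball (hl : (range l).Finite) (hp : p ∈ A.gDomC l) :
    ∃ r > 0, ∀ q ∈ tildeC M, ‖q - p‖ < r → q ∈ A.gDomC l ∧ q ∈ A.gDom l := by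
  obtain ⟨x, hx, hxM, hpM, C, hC, δ, hδ, h⟩ := exists_compact_of_mem_gDomC hl hp
  refine ⟨Real.exp (-1), Real.exp_pos _, fun q hq hqp => ?_⟩
  have key : ∀ y, Represents y q → (∀ᶠ ε in small, y ε ∈ M) → ∀ᶠ ε in small, y ε ∈ C (l ε) := by
    intro y hy hyM
    filter_upwards [h, hyM, hy.eventually_lt hx hqp, eventually_small_lt hδ] with ε h1 h2 h3 h4
    rw [Real.rpow_one] at h3
    exact h1 ⟨h2, mem_ball_iff_norm.2 (h3.trans h4)⟩
  obtain ⟨y, hy, hyM⟩ := exists_rep_of_mem_tildeC hq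
  exact ⟨⟨y, hy, C, hC, key y hy hyM⟩, hq, ⟨y, hy, hyM⟩, fun z hz hzM =>
    (key z hz hzM).mono fun ε hε => (hC _).2 hε⟩

theorem mem_tildeC_of_mem_gDomC (hl : (range l).Finite) (hp : p ∈ A.gDomC l) : p ∈ tildeC M := by
  obtain ⟨-, -, -, hpM, -⟩ := exists_compact_of_mem_gDomC hl hp
  exact hpM

theorem gDomC_subset_gDom (hl : (range l).Finite) : A.gDomC l ⊆ A.gDom l := by
  intro p hp
  obtain ⟨r, hr, h⟩ := gDomC_ball hl hp
  exact (h p (mem_tildeC_of_mem_gDomC hl hp) (by simpa using hr)).2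

theorem gDomC_relOpen (hl : (range l).Finite) : ∃ O, IsOpen O ∧ A.gDomC l = tildeC M ∩ O := by
  refine exists_open_of_forall_ball (fun p hp => mem_tildeC_of_mem_gDomC hl hp) fun p hp => ?_
  obtain ⟨r, hr, h⟩ := gDomC_ball hl hp
  exact ⟨r, hr, fun q hq hqp => (h q hq hqp).1⟩

theorem gDomC_nonempty (hl : (range l).Finite) : (A.gDomC l).Nonempty := by
  choose c hc using A.dom_nonempty
  obtain ⟨B, hB⟩ := exists_uniform_of_finite_range (P := fun a B => ‖c a‖ ≤ B) hl
    (fun _ _ _ h h' => h'.trans h) fun a => ⟨_, le_rfl⟩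
  exact ⟨_, fun ε => c (l ε), represents_of_bounded (C := B) (Eventually.of_forall hB),
    fun a => {c a}, fun a => ⟨isCompact_singleton, by simpa using hc a⟩, by simp⟩

theorem ofVec_mem_gDomC {a : Λ} {v : Euc N} (hv : v ∈ A.dom a) :
    ofVec v ∈ A.gDomC fun _ => a := by
  classical
  refine ⟨fun _ => v, represents_const v, fun b => if b = a then {v} else ∅, fun b => ?_, by simp⟩
  dsimp only
  split_ifs with h
  · exact ⟨isCompact_singleton, by simpa [h] using hv⟩
  · simp

theorem exists_mem_gDomC (hp : p ∈ tildeC M) :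
    ∃ l : Idx → Λ, (range l).Finite ∧ p ∈ A.gDomC l := by
  classical
  obtain ⟨x, hx, K, hK, hKM, hxK⟩ := hp
  obtain ⟨ε₀, hε₀⟩ := hxK.exists
  have : Nonempty Λ := ⟨(A.exists_dom (hKM hε₀)).choose⟩
  have h1 : ∀ v ∈ K, ∃ a, ∃ r > 0, ∃ C, IsCompact C ∧ C ⊆ A.dom a ∧ M ∩ Metric.ball v r ⊆ C := by
    intro v hv
    obtain ⟨a, ha⟩ := A.exists_dom (hKM hv)
    exact ⟨a, exists_ball_subset_dom ha⟩
  choose! a r hr C hC hCd h using h1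
  obtain ⟨t, htK, ht⟩ := hK.elim_nhds_subcover (fun v => Metric.ball v (r v))
    fun v hv => Metric.ball_mem_nhds v (hr v hv)
  have h2 : ∀ ε, x ε ∈ K → ∃ v ∈ t, x ε ∈ Metric.ball v (r v) := fun ε hε => by
    simpa using ht hε
  choose! c hct hc using h2
  -- Charts come from a finite subcover of `K`; the default value keeps the range finite. Several
  -- centres may carry the same chart, hence the unions of compact sets below.
  let l : Idx → Λ := fun ε => if x ε ∈ K then a (c ε) else a (c ε₀)
  refine ⟨l, (t.finite_toSet.image a).subset ?_, x, hx,
    fun b => ⋃ v ∈ {v | v ∈ t ∧ a v = b}, C v, fun b => ⟨?_, ?_⟩, ?_⟩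
  · rintro _ ⟨ε, rfl⟩
    simp only [l]
    split_ifs with hε
    · exact mem_image_of_mem a (hct ε hε)
    · exact mem_image_of_mem a (hct ε₀ hε₀)
  · exact (t.finite_toSet.subset fun v hv => hv.1).isCompact_biUnion fun v hv => hC v (htK v hv.1)
  · refine iUnion₂_subset fun v hv => ?_
    rw [← hv.2]
    exact hCd v (htK v hv.1)
  · filter_upwards [hxK] with ε hε
    have hl : l ε = a (c ε) := if_pos hε
    rw [hl]
    exact mem_iUnion₂.2 ⟨c ε, ⟨hct ε hε, rfl⟩, h _ (htK _ (hct ε hε)) ⟨hKM hε, hc ε hε⟩⟩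

/-! ### Regular points -/

variable (A) in
/-- The derivatives of the parametrizations `φ_{l(ε)}⁻¹` are bounded near `p`. -/
def IsRegularAt (l : Idx → Λ) (p : GVec N) : Prop :=
  ∃ x, Represents x p ∧ ∃ K : Λ → Set (Euc N), (∀ a, A.BddOver a (K a)) ∧
    ∃ δ > 0, ∀ᶠ ε in small, M ∩ Metric.ball (x ε) δ ⊆ K (l ε)

theorem isRegularAt_of_mem_gDomC (hl : (range l).Finite) (hp : p ∈ A.gDomC l) :
    A.IsRegularAt l p := by
  obtain ⟨x, hx, -, -, C, hC, δ, hδ, h⟩ := exists_compact_of_mem_gDomC hl hp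
  exact ⟨x, hx, C, fun a => bddOver_of_isCompact (hC a).1 (hC a).2, δ, hδ, h⟩

theorem HasBoundedDerivatives.isRegularAt (hA : A.HasBoundedDerivatives) (hp : p ∈ tildeC M) :
    A.IsRegularAt l p := by
  obtain ⟨x, hx, K, hK, hKM, hxK⟩ := hp
  obtain ⟨δ, hδ, C, hC, hCM, h⟩ := A.exists_compact hK hKM
  refine ⟨x, hx, fun _ => C, fun a k => derivBdd_iff.2 fun i _ => ?_, δ, hδ,
    hxK.mono fun ε hε => h _ hε⟩
  obtain ⟨B, hB⟩ := hA a i C hC hCM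
  exact ⟨B, fun y hy => hB y hy.1 hy.2⟩

theorem IsRegularAt.of_represents (h : A.IsRegularAt l p) (hy : Represents y p) :
    ∃ K : Λ → Set (Euc N), (∀ a, A.BddOver a (K a)) ∧ ∀ᶠ ε in small,
      M ∩ Metric.ball (y ε) ((ε : ℝ) ^ (1 : ℝ)) ⊆ K (l ε) := by
  obtain ⟨x, hx, K, hK, δ, hδ, h⟩ := h
  refine ⟨K, hK, ?_⟩
  filter_upwards [h, hy.eventually_lt_self hx 1, eventually_small_lt (half_pos hδ)] with ε h1 h2 h3
  rintro z ⟨hzM, hz⟩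
  refine h1 ⟨hzM, ?_⟩
  rw [Real.rpow_one] at *
  rw [Metric.mem_ball] at *
  rw [← dist_eq_norm] at h2
  linarith [dist_triangle z (y ε) (x ε)]

theorem netSmoothAt_param (hA : A.IsLipschitz) (hl : (range l).Finite) (hp : p ∈ A.gDom l)
    (hreg : A.IsRegularAt l p) (hx : Represents x p) (hxM : ∀ᶠ ε in small, x ε ∈ M) :
    NetSmoothAt (fun ε => A.param (l ε)) fun ε => A.chart (l ε) (x ε) := by
  obtain ⟨K, hK, hxK⟩ := hreg.of_represents hx
  -- Precision `t = 1` keeps the points over the ball within `ε` of `x ε`, where the derivatives are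
  -- bounded.
  obtain ⟨r, _, _, _, hr⟩ := exists_ball_subset_codom_of_mem_gDom hA hl hp hx hxM 1
  refine ⟨r, ?_, fun j => ?_⟩
  · filter_upwards [hr] with ε h1
    exact (A.param_contDiffOn (l ε)).mono fun w hw => (h1 w hw).1
  · obtain ⟨B, hB⟩ := exists_uniform_of_finite_range (P := fun a B =>
      ∀ w ∈ {w ∈ A.codom a | A.param a w ∈ K a}, ‖iteratedFDeriv ℝ j (A.param a) w‖ ≤ B) hl
      (fun _ _ _ h h' w hw => (h' w hw).trans h) fun a => derivBdd_iff.1 (hK a j) j le_rfl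
    refine ⟨B, ?_⟩
    filter_upwards [hr, hxK] with ε h1 h2 w hw
    obtain ⟨h3, -, h4, -⟩ := h1 w hw
    exact hB ε w ⟨h3, h2 ⟨dom_subset (param_mem h3), mem_ball_iff_norm.2 h4⟩⟩

theorem netSmoothAt_change (hA : A.IsLipschitz) (hl : (range l).Finite) (hl' : (range l').Finite)
    (hp : p ∈ A.gDom l) (hp' : p ∈ A.gDom l') (hreg : A.IsRegularAt l p)
    (hreg' : A.IsRegularAt l' p) (hx : Represents x p) (hxM : ∀ᶠ ε in small, x ε ∈ M) :
    NetSmoothAt (fun ε => A.change (l ε) (l' ε)) fun ε => A.chart (l ε) (x ε) := by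
  obtain ⟨K, hK, hxK⟩ := hreg.of_represents hx
  obtain ⟨K', hK', hxK'⟩ := hreg'.of_represents hx
  obtain ⟨m, hm⟩ := exists_ball_subset_dom_of_mem_gDom hp' hx
  -- Precision `m` keeps the points in the domains of `l'`, precision 1 in the region of bounded
  -- derivatives.
  obtain ⟨r, _, _, _, hr⟩ := exists_ball_subset_codom_of_mem_gDom hA hl hp hx hxM (max m 1)
  have hover : ∀ᶠ ε in small, ∀ w ∈ Metric.ball (A.chart (l ε) (x ε)) ((ε : ℝ) ^ r),
      w ∈ A.overlap (l ε) (l' ε) ∧ A.param (l ε) w ∈ K (l ε) ∩ K' (l' ε) := by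
    filter_upwards [hr, hm, hxK, hxK'] with ε h1 h2 h3 h4 w hw
    obtain ⟨h5, -, h6, -⟩ := h1 w hw
    have h7 := dom_subset (param_mem h5)
    have h8 := mem_ball_iff_norm.2 (h6.trans_le (eventually_rpow_le (le_max_right _ _) ε))
    exact ⟨⟨h5, h2 ⟨h7, mem_ball_iff_norm.2 (h6.trans_le (eventually_rpow_le (le_max_left _ _) ε))⟩⟩,
      h3 ⟨h7, h8⟩, h4 ⟨h7, h8⟩⟩
  refine ⟨r, ?_, fun j => ?_⟩
  · filter_upwards [hover] with ε h1
    exact (change_contDiffOn (l ε) (l' ε)).mono fun w hw => (h1 w hw).1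
  · have hfin : (range fun ε => (l ε, l' ε)).Finite := (hl.prod hl').subset (by
      rintro _ ⟨ε, rfl⟩
      exact ⟨mem_range_self ε, mem_range_self ε⟩)
    obtain ⟨B, hB⟩ := exists_uniform_of_finite_range (P := fun (c : Λ × Λ) B =>
      ∀ w ∈ {w ∈ A.overlap c.1 c.2 | A.param c.1 w ∈ K c.1 ∩ K' c.2},
        ‖iteratedFDeriv ℝ j (A.change c.1 c.2) w‖ ≤ B) hfin
      (fun _ _ _ h h' w hw => (h' w hw).trans h) fun c => by
        obtain ⟨L, hL⟩ := (hA c.2).1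
        exact derivBdd_iff.1 (change_derivBdd hL (hK c.1) (hK' c.2) j) j le_rfl
    refine ⟨B, ?_⟩
    filter_upwards [hover] with ε h1 w hw
    exact hB ε w (h1 w hw)

/-! ### Generalized charts on open subsets of `U_l` -/

variable {D D' : Set (GVec N)} {z z' : GVec n}

theorem gChart_injOn (hA : A.IsLipschitz) (hl : (range l).Finite) (hD : D ⊆ A.gDom l) :
    InjOn (A.gChart l) D := by
  intro p hp q hq h
  rw [← sub_eq_zero, ← norm_eq_zero, norm_gChart_sub hA hl (hD hp) (hD hq)] at h
  exact sub_eq_zero.1 (norm_eq_zero.1 h)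

theorem chartInv_mem {φ : GVec N → GVec n} (hz : z ∈ φ '' D) : chartInv D φ z ∈ D :=
  Function.invFunOn_mem hz

theorem apply_chartInv {φ : GVec N → GVec n} (hz : z ∈ φ '' D) : φ (chartInv D φ z) = z :=
  Function.invFunOn_eq hz

theorem chartInv_gChart (hA : A.IsLipschitz) (hl : (range l).Finite) (hD : D ⊆ A.gDom l)
    (hp : p ∈ D) : chartInv D (A.gChart l) (A.gChart l p) = p :=
  gChart_injOn hA hl hD (chartInv_mem (mem_image_of_mem _ hp)) hp
    (apply_chartInv (mem_image_of_mem _ hp))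

theorem norm_chartInv_sub (hA : A.IsLipschitz) (hl : (range l).Finite) (hD : D ⊆ A.gDom l)
    (hz : z ∈ A.gChart l '' D) (hz' : z' ∈ A.gChart l '' D) :
    ‖chartInv D (A.gChart l) z - chartInv D (A.gChart l) z'‖ = ‖z - z'‖ := by
  rw [← norm_gChart_sub hA hl (hD (chartInv_mem hz)) (hD (chartInv_mem hz')), apply_chartInv hz,
    apply_chartInv hz']

theorem represents_param_chart (hp : p ∈ A.gDom l) (hx : Represents x p)
    (hxM : ∀ᶠ ε in small, x ε ∈ M) :
    Represents (fun ε => A.param (l ε) (A.chart (l ε) (x ε))) p := by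
  refine hx.congr ?_
  filter_upwards [eventually_mem_dom hp hx hxM] with ε h1 using A.left_inv _ _ h1

theorem represents_change_chart (hA : A.IsLipschitz) (hl' : (range l').Finite) (hp : p ∈ A.gDom l)
    (hp' : p ∈ A.gDom l') (hx : Represents x p) (hxM : ∀ᶠ ε in small, x ε ∈ M) :
    Represents (fun ε => A.change (l ε) (l' ε) (A.chart (l ε) (x ε))) (A.gChart l' p) := by
  refine (represents_gChart hA hl' hp' hx hxM).congr ?_
  filter_upwards [eventually_mem_dom hp hx hxM] with ε h1
  rw [change, Function.comp_apply, A.left_inv _ _ h1]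

theorem chartInv_represents (hA : A.IsLipschitz) (hl : (range l).Finite) (hD : D ⊆ A.gDom l)
    (hDo : ∃ O, IsOpen O ∧ D = tildeC M ∩ O) (hp : p ∈ D) :
    ∀ᶠ z in 𝓝 (A.gChart l p), ∃ y, Represents y z ∧
      Represents (fun ε => A.param (l ε) (y ε)) (chartInv D (A.gChart l) z) := by
  filter_upwards [(isOpen_gChart_image hA hl hD hDo).mem_nhds (mem_image_of_mem _ hp)]
  rintro _ ⟨q, hq, rfl⟩
  obtain ⟨y, hy, hyM⟩ := exists_rep_of_mem_tildeC (hD hq).1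
  rw [chartInv_gChart hA hl hD hq]
  exact ⟨_, represents_gChart hA hl (hD hq) hy hyM, represents_param_chart (hD hq) hy hyM⟩

theorem hasGDerivAt_chartInv (hA : A.IsLipschitz) (hl : (range l).Finite) (hD : D ⊆ A.gDom l)
    (hDo : ∃ O, IsOpen O ∧ D = tildeC M ∩ O) (hp : p ∈ D) (hreg : A.IsRegularAt l p)
    (hx : Represents x p) (hxM : ∀ᶠ ε in small, x ε ∈ M) :
    HasGDerivAt (chartInv D (A.gChart l))
      (netDeriv (fun ε => A.param (l ε)) fun ε => A.chart (l ε) (x ε)) (A.gChart l p) := by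
  refine (netSmoothAt_param hA hl (hD hp) hreg hx hxM).hasGDerivAt
    (represents_gChart hA hl (hD hp) hx hxM) ?_ (chartInv_represents hA hl hD hDo hp)
  rw [chartInv_gChart hA hl hD hp]
  exact (represents_param_chart (hD hp) hx hxM).2.symm

theorem inter_relOpen {S D D' : Set (GVec N)} (hD : ∃ O, IsOpen O ∧ D = S ∩ O)
    (hD' : ∃ O, IsOpen O ∧ D' = S ∩ O) : ∃ O, IsOpen O ∧ D ∩ D' = S ∩ O := by
  obtain ⟨O, hO, rfl⟩ := hD
  obtain ⟨O', hO', rfl⟩ := hD'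
  exact ⟨O ∩ O', hO.inter hO', by rw [← inter_inter_distrib_left]⟩

theorem hasGDerivAt_transition (hA : A.IsLipschitz) (hl : (range l).Finite)
    (hl' : (range l').Finite) (hD : D ⊆ A.gDom l) (hD' : D' ⊆ A.gDom l')
    (hDo : ∃ O, IsOpen O ∧ D = tildeC M ∩ O) (hDo' : ∃ O, IsOpen O ∧ D' = tildeC M ∩ O)
    (hp : p ∈ D ∩ D') (hreg : A.IsRegularAt l p) (hreg' : A.IsRegularAt l' p)
    (hx : Represents x p) (hxM : ∀ᶠ ε in small, x ε ∈ M) :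
    HasGDerivAt (A.gChart l' ∘ chartInv D (A.gChart l))
      (netDeriv (fun ε => A.change (l ε) (l' ε)) fun ε => A.chart (l ε) (x ε))
      (A.gChart l p) := by
  refine (netSmoothAt_change hA hl hl' (hD hp.1) (hD' hp.2) hreg hreg' hx hxM).hasGDerivAt
    (represents_gChart hA hl (hD hp.1) hx hxM) ?_ ?_
  · rw [Function.comp_apply, chartInv_gChart hA hl hD hp.1]
    exact (represents_change_chart hA hl' (hD hp.1) (hD' hp.2) hx hxM).2.symm
  · filter_upwards [(isOpen_gChart_image hA hl (inter_subset_left.trans hD)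
      (inter_relOpen hDo hDo')).mem_nhds (mem_image_of_mem _ hp)]
    rintro _ ⟨q, hq, rfl⟩
    obtain ⟨y, hy, hyM⟩ := exists_rep_of_mem_tildeC (hD hq.1).1
    rw [Function.comp_apply, chartInv_gChart hA hl hD hq.1]
    exact ⟨_, represents_gChart hA hl (hD hq.1) hy hyM,
      represents_change_chart hA hl' (hD hq.1) (hD' hq.2) hy hyM⟩

theorem gSmoothOn_transition (hA : A.IsLipschitz) (hl : (range l).Finite)
    (hl' : (range l').Finite) (hD : D ⊆ A.gDom l) (hD' : D' ⊆ A.gDom l')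
    (hDo : ∃ O, IsOpen O ∧ D = tildeC M ∩ O) (hDo' : ∃ O, IsOpen O ∧ D' = tildeC M ∩ O)
    (hreg : ∀ p ∈ D, A.IsRegularAt l p) (hreg' : ∀ p ∈ D', A.IsRegularAt l' p) :
    GSmoothOn (A.gChart l' ∘ chartInv D (A.gChart l)) (A.gChart l '' (D ∩ D')) := by
  refine NetSmoothOn.gSmoothOn (f := fun ε => A.change (l ε) (l' ε)) ?_
    (isOpen_gChart_image hA hl (inter_subset_left.trans hD) (inter_relOpen hDo hDo'))
  rintro _ ⟨p, hp, rfl⟩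
  obtain ⟨x, hx, hxM⟩ := exists_rep_of_mem_tildeC (hD hp.1).1
  refine ⟨_, represents_gChart hA hl (hD hp.1) hx hxM, netSmoothAt_change hA hl hl' (hD hp.1)
    (hD' hp.2) (hreg p hp.1) (hreg' p hp.2) hx hxM, ?_⟩
  rw [Function.comp_apply, chartInv_gChart hA hl hD hp.1]
  exact (represents_change_chart hA hl' (hD hp.1) (hD' hp.2) hx hxM).2.symm

theorem isGDiffeo_transition (hA : A.IsLipschitz) (hl : (range l).Finite)
    (hl' : (range l').Finite) (hD : D ⊆ A.gDom l) (hD' : D' ⊆ A.gDom l')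
    (hDo : ∃ O, IsOpen O ∧ D = tildeC M ∩ O) (hDo' : ∃ O, IsOpen O ∧ D' = tildeC M ∩ O)
    (hreg : ∀ p ∈ D, A.IsRegularAt l p) (hreg' : ∀ p ∈ D', A.IsRegularAt l' p) :
    IsGDiffeo (A.gChart l' ∘ chartInv D (A.gChart l)) (A.gChart l '' (D ∩ D'))
      (A.gChart l' '' (D ∩ D')) := by
  refine ⟨isOpen_gChart_image hA hl (inter_subset_left.trans hD) (inter_relOpen hDo hDo'),
    isOpen_gChart_image hA hl' (inter_subset_right.trans hD') (inter_relOpen hDo hDo'), ?_,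
    gSmoothOn_transition hA hl hl' hD hD' hDo hDo' hreg hreg',
    A.gChart l ∘ chartInv D' (A.gChart l'), ?_, ⟨?_, ?_⟩, ?_⟩
  · rintro _ ⟨p, hp, rfl⟩
    rw [Function.comp_apply, chartInv_gChart hA hl hD hp.1]
    exact mem_image_of_mem _ hp
  · rintro _ ⟨p, hp, rfl⟩
    rw [Function.comp_apply, chartInv_gChart hA hl' hD' hp.2]
    exact mem_image_of_mem _ hp
  · rintro _ ⟨p, hp, rfl⟩
    simp only [Function.comp_apply]
    rw [chartInv_gChart hA hl hD hp.1, chartInv_gChart hA hl' hD' hp.2]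
  · rintro _ ⟨p, hp, rfl⟩
    simp only [Function.comp_apply]
    rw [chartInv_gChart hA hl' hD' hp.2, chartInv_gChart hA hl hD hp.1]
  · rw [inter_comm]
    exact gSmoothOn_transition hA hl' hl hD' hD hDo' hDo hreg' hreg

/-- Ensures that the truncated difference `N - n` is the true codimension. -/
theorem dim_le (A : SubmanifoldAtlas M n Λ) (hM : M.Nonempty) : n ≤ N := by
  obtain ⟨v, hv⟩ := hM
  obtain ⟨a, ha⟩ := A.exists_dom hv
  have h := A.param_immersion a _ (chart_mem ha)
  simpa using LinearMap.finrank_le_finrank_of_injective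
    (f := (fderiv ℝ (A.param a) (A.chart a v) : Euc n →ₗ[ℝ] Euc N)) h

/-- `M̃_c` is a generalized submanifold for every family of open parts of the `U_l` that covers it
and consists of regular points. -/
theorem isGSubmanifold_of_isRegularAt (hM : M.Nonempty) (hA : A.IsLipschitz)
    {D : FinRange Λ → Set (GVec N)} (hD : ∀ l, D l ⊆ A.gDom l.1) (hne : ∀ l, (D l).Nonempty)
    (hDo : ∀ l, ∃ O, IsOpen O ∧ D l = tildeC M ∩ O) (hcover : ⋃ l, D l = tildeC M)
    (hreg : ∀ l, ∀ p ∈ D l, A.IsRegularAt l.1 p) :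
    IsGSubmanifold (N - n) (tildeC M) D fun l => A.gChart l.1 where
  nonempty := by
    obtain ⟨v, hv⟩ := hM
    exact ⟨ofVec v, fun _ => v, represents_const v, {v}, isCompact_singleton, by simpa using hv,
      by simp⟩
  dom_nonempty := hne
  dom_open := hDo
  injOn l := gChart_injOn hA l.2 (hD l)
  image_open l := isOpen_gChart_image hA l.2 (hD l) (hDo l)
  cover := hcover
  transition i j _ := isGDiffeo_transition hA i.2 j.2 (hD i) (hD j) (hDo i) (hDo j) (hreg i) (hreg j)
  codim := Nat.add_sub_of_le (A.dim_le hM)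
  continuousOn l := by
    have h : LipschitzOnWith 1 (A.gChart l.1) (D l) := LipschitzOnWith.of_dist_le_mul
      fun p hp q hq => by
        rw [dist_eq_norm, dist_eq_norm, norm_gChart_sub hA l.2 (hD l hp) (hD l hq)]
        simp
    exact h.continuousOn
  continuousOn_inv l := by
    have h : LipschitzOnWith 1 (chartInv (D l) (A.gChart l.1)) (A.gChart l.1 '' D l) :=
      LipschitzOnWith.of_dist_le_mul fun z hz z' hz' => by
        rw [dist_eq_norm, dist_eq_norm, norm_chartInv_sub hA l.2 (hD l) hz hz']
        simp
    exact h.continuousOn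
  smooth_inclusion l := by
    refine NetSmoothOn.gSmoothOn (f := fun ε => A.param (l.1 ε)) ?_
      (isOpen_gChart_image hA l.2 (hD l) (hDo l))
    rintro _ ⟨p, hp, rfl⟩
    obtain ⟨x, hx, hxM⟩ := exists_rep_of_mem_tildeC (hD l hp).1
    refine ⟨_, represents_gChart hA l.2 (hD l hp) hx hxM,
      netSmoothAt_param hA l.2 (hD l hp) (hreg l p hp) hx hxM, ?_⟩
    rw [chartInv_gChart hA l.2 (hD l) hp]
    exact (represents_param_chart (hD l hp) hx hxM).2.symm
  immersion l := by
    rintro _ ⟨p, hp, rfl⟩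
    obtain ⟨x, hx, hxM⟩ := exists_rep_of_mem_tildeC (hD l hp).1
    have h := hasGDerivAt_chartInv hA l.2 (hD l) (hDo l) hp (hreg l p hp) hx hxM
    -- Injectivity comes from the inverse chart being an isometry for the sharp norms.
    refine ⟨_, h, h.injective ?_⟩
    filter_upwards [(isOpen_gChart_image hA l.2 (hD l) (hDo l)).mem_nhds (mem_image_of_mem _ hp)]
      with z hz
    rw [norm_chartInv_sub hA l.2 (hD l) hz (mem_image_of_mem _ hp)]

end SubmanifoldAtlas

/-! ### The intrinsic distance -/

section CurveDist

variable {N : ℕ} {M : Set (Euc N)} {p q u : Euc N}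

/-- The curves in `M` from `p` to `q`, parametrized by `[0, 1]`. -/
def curves (M : Set (Euc N)) (p q : Euc N) : Set (ℝ → Euc N) :=
  {γ | ContinuousOn γ (Icc 0 1) ∧ MapsTo γ (Icc 0 1) M ∧ γ 0 = p ∧ γ 1 = q}

/-- The infimum of the lengths of the curves in `M` from `p` to `q`, possibly infinite. -/
noncomputable def curveDist (M : Set (Euc N)) (p q : Euc N) : ENNReal :=
  ⨅ γ ∈ curves M p q, eVariationOn γ (Icc 0 1)

theorem edist_le_curveDist : edist p q ≤ curveDist M p q := by
  refine le_iInf₂ fun γ hγ => ?_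
  obtain ⟨-, -, rfl, rfl⟩ := hγ
  exact eVariationOn.edist_le γ (by simp) (by simp)

theorem exists_concat {γ₁ γ₂ : ℝ → Euc N} (h₁ : γ₁ ∈ curves M p q) (h₂ : γ₂ ∈ curves M q u) :
    ∃ γ ∈ curves M p u,
      eVariationOn γ (Icc 0 1) ≤ eVariationOn γ₁ (Icc 0 1) + eVariationOn γ₂ (Icc 0 1) := by
  obtain ⟨hc₁, hM₁, h10, h11⟩ := h₁
  obtain ⟨hc₂, hM₂, h20, h21⟩ := h₂
  let γ : ℝ → Euc N := fun t => if t ≤ 1 / 2 then γ₁ (2 * t) else γ₂ (2 * t - 1)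
  have e1 : EqOn γ (γ₁ ∘ fun t => 2 * t) (Icc 0 (1 / 2)) := fun t ht => if_pos ht.2
  have e2 : EqOn γ (γ₂ ∘ fun t => 2 * t - 1) (Icc (1 / 2) 1) := by
    intro t ht
    rcases ht.1.eq_or_lt with rfl | h
    · simp only [γ, le_refl, if_true, Function.comp_apply]
      norm_num
      rw [h11, h20]
    · exact if_neg (not_le.2 h)
  have m1 : MapsTo (fun t : ℝ => 2 * t) (Icc 0 (1 / 2)) (Icc 0 1) := fun t ht =>
    ⟨by linarith [ht.1], by linarith [ht.2]⟩
  have m2 : MapsTo (fun t : ℝ => 2 * t - 1) (Icc (1 / 2) 1) (Icc 0 1) := fun t ht =>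
    ⟨by linarith [ht.1], by linarith [ht.2]⟩
  have hun : Icc (0 : ℝ) (1 / 2) ∪ Icc (1 / 2) 1 = Icc 0 1 :=
    Icc_union_Icc_eq_Icc (by norm_num) (by norm_num)
  refine ⟨γ, ⟨?_, ?_, ?_, ?_⟩, ?_⟩
  · rw [← hun]
    refine ContinuousOn.union_of_isClosed ?_ ?_ isClosed_Icc isClosed_Icc
    · exact (hc₁.comp (by fun_prop) m1).congr e1
    · exact (hc₂.comp (by fun_prop) m2).congr e2
  · rw [← hun]
    rintro t (ht | ht)
    · rw [e1 ht]; exact hM₁ (m1 ht)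
    · rw [e2 ht]; exact hM₂ (m2 ht)
  · rw [e1 (by norm_num)]; simpa using h10
  · rw [e2 (by norm_num), Function.comp_apply]; norm_num [h21]
  · have h := eVariationOn.Icc_add_Icc γ (s := univ) (a := 0) (b := 1 / 2) (c := 1) (by norm_num)
      (by norm_num) (mem_univ _)
    simp only [univ_inter] at h
    rw [← h, eVariationOn.congr e1, eVariationOn.congr e2]
    refine add_le_add (eVariationOn.comp_le_of_monotoneOn _ _ ?_ m1)
      (eVariationOn.comp_le_of_monotoneOn _ _ ?_ m2)
    · exact fun s _ t _ hst => by linarith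
    · exact fun s _ t _ hst => by linarith

theorem intrinsicDist_nonneg : 0 ≤ intrinsicDist M p q := ENNReal.toReal_nonneg

theorem curveDist_triangle : curveDist M p u ≤ curveDist M p q + curveDist M q u := by
  refine ENNReal.le_iInf₂_add_iInf₂ fun γ₁ h₁ γ₂ h₂ => ?_
  obtain ⟨γ, hγ, hle⟩ := exists_concat h₁ h₂
  exact (iInf₂_le γ hγ).trans hle

theorem curveDist_le_of_lipschitz {γ : ℝ → Euc N} {C : NNReal} (hγ : γ ∈ curves M p q)
    (hC : LipschitzOnWith C γ (Icc 0 1)) : curveDist M p q ≤ C := by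
  have h1 := hC.comp_eVariationOn_le (g := id) (mapsTo_id _)
  exact (iInf₂_le γ hγ).trans (h1.trans (by simp))

end CurveDist

namespace SubmanifoldAtlas

variable {N n : ℕ} {M : Set (Euc N)} {Λ : Type*} {A : SubmanifoldAtlas M n Λ}

/-- Locally, the intrinsic distance is bounded by a multiple of the ambient distance. -/
theorem exists_curveDist_le (hA : A.IsLipschitz) {p : Euc N} (hp : p ∈ M) :
    ∃ r > 0, ∃ C : NNReal, ∀ q ∈ M ∩ Metric.ball p r, ∀ u ∈ M ∩ Metric.ball p r,
      curveDist M q u ≤ C * edist q u := by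
  obtain ⟨a, ha⟩ := A.exists_dom hp
  obtain ⟨⟨L, hL⟩, L', hL'⟩ := hA a
  obtain ⟨s, hs, C, -, hCd, hC⟩ := exists_ball_subset_dom ha
  obtain ⟨ρ, hρ, hball⟩ := Metric.isOpen_iff.1 (A.codom_open a) _ (chart_mem ha)
  -- The `L`-Lipschitz chart sends the ball of this radius into the coordinate ball of radius `ρ`,
  -- which is convex: straight segments there lift to Lipschitz curves in `M`.
  have hr : 0 < min s (ρ / (L + 1)) := lt_min hs (by positivity)
  have hdom : ∀ q ∈ M ∩ Metric.ball p (min s (ρ / (L + 1))), q ∈ A.dom a ∧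
      A.chart a q ∈ Metric.ball (A.chart a p) ρ := by
    rintro q ⟨hq, hqb⟩
    have hqd : q ∈ A.dom a := hCd (hC ⟨hq, Metric.ball_subset_ball (min_le_left _ _) hqb⟩)
    refine ⟨hqd, ?_⟩
    have h1 := hL.dist_le_mul q hqd p ha
    have h2 := (Metric.mem_ball.1 hqb).trans_le (min_le_right _ _)
    rw [lt_div_iff₀ (by positivity)] at h2
    rw [Metric.mem_ball]
    nlinarith [dist_nonneg (x := q) (y := p), L.2]
  refine ⟨_, hr, L' * L, fun q hq u hu => ?_⟩
  obtain ⟨hqd, hqb⟩ := hdom q hq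
  obtain ⟨hud, hub⟩ := hdom u hu
  have hline : MapsTo (AffineMap.lineMap (A.chart a q) (A.chart a u) : ℝ → Euc n) (Icc 0 1)
      (A.codom a) := by
    intro t ht
    exact hball ((convex_ball _ _).lineMap_mem hqb hub ht)
  have hlip : LipschitzOnWith (L' * nndist (A.chart a q) (A.chart a u))
      (A.param a ∘ (AffineMap.lineMap (A.chart a q) (A.chart a u) : ℝ → Euc n)) (Icc 0 1) :=
    hL'.comp (lipschitzWith_lineMap _ _).lipschitzOnWith hline
  refine (curveDist_le_of_lipschitz ⟨hlip.continuousOn, fun t ht =>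
    dom_subset (param_mem (hline ht)), ?_, ?_⟩ hlip).trans ?_
  · simp [A.left_inv a q hqd]
  · simp [A.left_inv a u hud]
  · push_cast
    rw [mul_assoc]
    gcongr
    exact hL hqd hud

/-- Being at finite distance holds locally in both directions and is transitive, so it propagates
over a connected set. Without finiteness, `toReal` would send an infinite distance to 0. -/
theorem curveDist_ne_top (hA : A.IsLipschitz) (hM : IsPreconnected M) {p q : Euc N} (hp : p ∈ M)
    (hq : q ∈ M) : curveDist M p q ≠ ⊤ := by
  refine hM.induction₂' (fun p q => curveDist M p q ≠ ⊤) (fun p hp => ?_)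
    (fun x y z _ _ _ h h' => ?_) hp hq
  · obtain ⟨r, hr, C, hC⟩ := exists_curveDist_le hA hp
    have hself : p ∈ M ∩ Metric.ball p r := ⟨hp, Metric.mem_ball_self hr⟩
    filter_upwards [inter_mem_nhdsWithin M (Metric.ball_mem_nhds p hr)] with q hq
    exact ⟨ne_top_of_le_ne_top (by finiteness) (hC p hself q hq),
      ne_top_of_le_ne_top (by finiteness) (hC q hq p hself)⟩
  · exact ne_top_of_le_ne_top (ENNReal.add_ne_top.2 ⟨h, h'⟩) (curveDist_triangle (q := y))

theorem intrinsicDist_triangle (hA : A.IsLipschitz) (hM : IsPreconnected M) {p q u : Euc N}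
    (hp : p ∈ M) (hq : q ∈ M) (hu : u ∈ M) :
    intrinsicDist M p u ≤ intrinsicDist M p q + intrinsicDist M q u := by
  have h1 := curveDist_ne_top hA hM hp hq
  have h2 := curveDist_ne_top hA hM hq hu
  have h := ENNReal.toReal_mono (ENNReal.add_ne_top.2 ⟨h1, h2⟩) (curveDist_triangle (M := M))
  rwa [ENNReal.toReal_add h1 h2] at h

theorem norm_sub_le_intrinsicDist (hA : A.IsLipschitz) (hM : IsPreconnected M) {p q : Euc N}
    (hp : p ∈ M) (hq : q ∈ M) : ‖p - q‖ ≤ intrinsicDist M p q := by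
  have h := ENNReal.toReal_mono (curveDist_ne_top hA hM hp hq) edist_le_curveDist
  rwa [edist_dist, ENNReal.toReal_ofReal dist_nonneg, dist_eq_norm] at h

theorem exists_intrinsicDist_le (hA : A.IsLipschitz) {p : Euc N} (hp : p ∈ M) :
    ∃ r > 0, ∃ C : ℝ, 0 ≤ C ∧ ∀ q ∈ M ∩ Metric.ball p r, ∀ u ∈ M ∩ Metric.ball p r,
      intrinsicDist M q u ≤ C * ‖q - u‖ := by
  obtain ⟨r, hr, C, hC⟩ := exists_curveDist_le hA hp
  refine ⟨r, hr, C, C.2, fun q hq u hu => ?_⟩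
  have h := ENNReal.toReal_mono (by finiteness) (hC q hq u hu)
  rwa [ENNReal.toReal_mul, edist_dist, ENNReal.toReal_ofReal dist_nonneg, dist_eq_norm] at h

/-- On compact subsets of a connected `M`, the intrinsic distance is bounded by a multiple of the
ambient distance. -/
theorem exists_intrinsicDist_le_of_isCompact (hA : A.IsLipschitz) (hM : IsPreconnected M)
    {K : Set (Euc N)} (hK : IsCompact K) (hKM : K ⊆ M) :
    ∃ C : ℝ, ∀ q ∈ K, ∀ u ∈ K, intrinsicDist M q u ≤ C * ‖q - u‖ := by
  -- Otherwise some pairs have intrinsic distance above `k` times the ambient one; pass to a limit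
  -- `(p, p')`. If `p = p'`, the local estimate is violated. If not, the ambient distances stay away
  -- from 0 while the intrinsic ones are bounded through `p` and `p'`.
  by_contra! hcon
  choose q hq u hu hlt using fun k : ℕ => hcon k
  obtain ⟨⟨p, p'⟩, hpp, φ, hφ, hlim⟩ := (hK.prod hK).tendsto_subseq
    (x := fun k => (q k, u k)) fun k => ⟨hq k, hu k⟩
  have hq' : Tendsto (fun k => q (φ k)) atTop (𝓝 p) := (continuous_fst.tendsto _).comp hlim
  have hu' : Tendsto (fun k => u (φ k)) atTop (𝓝 p') := (continuous_snd.tendsto _).comp hlim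
  have hpM := hKM hpp.1
  have hpM' := hKM hpp.2
  obtain ⟨r, hr, C, hC0, hC⟩ := exists_intrinsicDist_le hA hpM
  obtain ⟨r', hr', C', hC0', hC'⟩ := exists_intrinsicDist_le hA hpM'
  have hqb := hq'.eventually (Metric.ball_mem_nhds p hr)
  have hub := hu'.eventually (Metric.ball_mem_nhds p' hr')
  have hφ' : Tendsto (fun k => (φ k : ℝ)) atTop atTop :=
    tendsto_natCast_atTop_atTop.comp hφ.tendsto_atTop
  rcases eq_or_ne p p' with rfl | hne
  · obtain ⟨k, h1, h2, h3⟩ := (hqb.and ((hu'.eventually (Metric.ball_mem_nhds p hr)).and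
      (hφ'.eventually_ge_atTop C))).exists
    have h4 := hC _ ⟨hKM (hq _), h1⟩ _ ⟨hKM (hu _), h2⟩
    have h5 := hlt (φ k)
    nlinarith [norm_nonneg (q (φ k) - u (φ k))]
  · have hpos : 0 < ‖p - p'‖ / 2 := by
      have := norm_pos_iff.2 (sub_ne_zero.2 hne); linarith
    have hd : ∀ᶠ k in atTop, ‖p - p'‖ / 2 < ‖q (φ k) - u (φ k)‖ :=
      (hq'.sub hu').norm.eventually (lt_mem_nhds (by linarith))
    obtain ⟨k, h1, h2, h3, h4⟩ := (hqb.and (hub.and (hd.and (hφ'.eventually_ge_atTop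
      ((C * r + intrinsicDist M p p' + C' * r') / (‖p - p'‖ / 2)))))).exists
    have hqM := hKM (hq (φ k))
    have huM := hKM (hu (φ k))
    have h5 := hC _ ⟨hqM, h1⟩ p ⟨hpM, Metric.mem_ball_self hr⟩
    have h6 := hC' p' ⟨hpM', Metric.mem_ball_self hr'⟩ _ ⟨huM, h2⟩
    have h7 := intrinsicDist_triangle hA hM hqM hpM huM
    have h8 := intrinsicDist_triangle hA hM hpM hpM' huM
    have h9 : ‖q (φ k) - p‖ < r := mem_ball_iff_norm.1 h1
    have h10 : ‖p' - u (φ k)‖ < r' := by rw [norm_sub_rev]; exact mem_ball_iff_norm.1 h2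
    have h11 := mul_le_mul_of_nonneg_left h9.le hC0
    have h12 := mul_le_mul_of_nonneg_left h10.le hC0'
    rw [div_le_iff₀ hpos] at h4
    have h13 := hlt (φ k)
    have h14 := mul_le_mul_of_nonneg_left h3.le (Nat.cast_nonneg (α := ℝ) (φ k))
    linarith

/-- On compact sets `d_M` lies between the ambient distance and a multiple of it, whence equal
norms. The triangle inequality bounds the effect of changing representatives by a multiple of their
negligible differences. -/
theorem exists_generalized_distance (hA : A.IsLipschitz) (hM : IsPreconnected M) :
    ∃ D : GVec N → GVec N → GReal, ∀ p ∈ tildeC M, ∀ q ∈ tildeC M,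
      ‖D p q‖ = ‖p - q‖ ∧
      ∀ x y, Represents x p → Represents y q →
        (∃ K, IsCompact K ∧ K ⊆ M ∧ ∀ᶠ ε in small, x ε ∈ K ∧ y ε ∈ K) →
        IsModerate (fun ε => intrinsicDist M (x ε) (y ε)) ∧
        netClass (fun ε => intrinsicDist M (x ε) (y ε)) = D p q := by
  have hex : ∀ p ∈ tildeC M, ∃ x, Represents x p ∧ ∃ K, IsCompact K ∧ K ⊆ M ∧
      ∀ᶠ ε in small, x ε ∈ K := fun p hp => hp
  choose! c hc S hS hSM hcS using hex
  have hmod : ∀ p ∈ tildeC M, ∀ q ∈ tildeC M, ∀ x y, Represents x p → Represents y q →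
      (∃ K, IsCompact K ∧ K ⊆ M ∧ ∀ᶠ ε in small, x ε ∈ K ∧ y ε ∈ K) →
      IsModerate (fun ε => intrinsicDist M (x ε) (y ε)) ∧
        (netNorm fun ε => intrinsicDist M (x ε) (y ε)) = ‖p - q‖ := by
    rintro p hp q hq x y hx hy ⟨K, hK, hKM, hxy⟩
    obtain ⟨C, hC⟩ := exists_intrinsicDist_le_of_isCompact hA hM hK hKM
    have hm := (hx.sub hy).isModerate_norm
    have h1 : ∀ᶠ ε in small, |intrinsicDist M (x ε) (y ε)| ≤ C * |‖x ε - y ε‖| := by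
      filter_upwards [hxy] with ε hε
      rw [abs_norm, abs_of_nonneg intrinsicDist_nonneg]
      exact hC _ hε.1 _ hε.2
    refine ⟨hm.of_le h1, ?_⟩
    rw [← (hx.sub hy).netNorm_norm]
    refine le_antisymm (netNorm_mono hm h1) (netNorm_mono (hm.of_le h1) (C := 1) ?_)
    filter_upwards [hxy] with ε hε
    rw [abs_norm, abs_of_nonneg intrinsicDist_nonneg, one_mul]
    exact norm_sub_le_intrinsicDist hA hM (hKM hε.1) (hKM hε.2)
  have hcc : ∀ p ∈ tildeC M, ∀ q ∈ tildeC M, ∃ K, IsCompact K ∧ K ⊆ M ∧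
      ∀ᶠ ε in small, c p ε ∈ K ∧ c q ε ∈ K := fun p hp q hq =>
    ⟨S p ∪ S q, (hS p hp).union (hS q hq), union_subset (hSM p hp) (hSM q hq), by
      filter_upwards [hcS p hp, hcS q hq] with ε h1 h2 using ⟨Or.inl h1, Or.inr h2⟩⟩
  refine ⟨fun p q => netClass fun ε => intrinsicDist M (c p ε) (c q ε), fun p hp q hq => ?_⟩
  obtain ⟨h1, h2⟩ := hmod p hp q hq _ _ (hc p hp) (hc q hq) (hcc p hp q hq)
  refine ⟨by rw [norm_netClass h1, h2], fun x y hx hy hxy => ?_⟩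
  obtain ⟨h3, -⟩ := hmod p hp q hq x y hx hy hxy
  refine ⟨h3, (netClass_eq_iff h3 h1).2 ?_⟩
  obtain ⟨K, hK, hKM, hxyK⟩ := hxy
  obtain ⟨C, hC⟩ := exists_intrinsicDist_le_of_isCompact hA hM
    (hK.union ((hS p hp).union (hS q hq)))
    (union_subset hKM (union_subset (hSM p hp) (hSM q hq)))
  have hneg : IsNegligible fun ε => ‖x ε - c p ε‖ + ‖y ε - c q ε‖ := by
    have hx' := isNegligible_iff.1 (hx.negligible (hc p hp))
    have hy' := isNegligible_iff.1 (hy.negligible (hc q hq))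
    exact isNegligible_iff.2 fun r => orders_add (hx' (r + 1)) (hy' (r + 1)) (by linarith)
  refine hneg.of_le (C := C) ?_
  filter_upwards [hxyK, hcS p hp, hcS q hq] with ε ⟨h4, h5⟩ h6 h7
  -- Each estimate is taken in both orders, which avoids using the symmetry of `intrinsicDist`.
  have e1 := hC (x ε) (Or.inl h4) (c p ε) (Or.inr (Or.inl h6))
  have e2 := hC (c p ε) (Or.inr (Or.inl h6)) (x ε) (Or.inl h4)
  have e3 := hC (y ε) (Or.inl h5) (c q ε) (Or.inr (Or.inr h7))
  have e4 := hC (c q ε) (Or.inr (Or.inr h7)) (y ε) (Or.inl h5)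
  rw [norm_sub_rev] at e2 e4
  have i1 := hKM h4
  have i2 := hKM h5
  have i3 := hSM p hp h6
  have i4 := hSM q hq h7
  have t1 := intrinsicDist_triangle hA hM i1 i3 i2
  have t2 := intrinsicDist_triangle hA hM i3 i4 i2
  have t3 := intrinsicDist_triangle hA hM i3 i1 i4
  have t4 := intrinsicDist_triangle hA hM i1 i2 i4
  rw [abs_of_nonneg (add_nonneg (norm_nonneg (x ε - c p ε)) (norm_nonneg (y ε - c q ε))),
    Pi.sub_apply, abs_le]
  constructor <;> linarith

end SubmanifoldAtlas

/-! ### Classical points, and coverings by generalized charts -/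

theorem ofVec_mem_tildeC {N : ℕ} {M : Set (Euc N)} {v : Euc N} (hv : v ∈ M) :
    ofVec v ∈ tildeC M :=
  ⟨fun _ => v, represents_const v, {v}, isCompact_singleton, by simpa using hv, by simp⟩

theorem discreteTopology_ofVec_image {N : ℕ} (M : Set (Euc N)) :
    DiscreteTopology (ofVec '' M : Set (GVec N)) := by
  refine DiscreteTopology.of_forall_le_dist one_pos ?_
  rintro ⟨_, v, _, rfl⟩ ⟨_, w, _, rfl⟩ hne
  rw [Subtype.dist_eq, dist_eq_norm, norm_ofVec_sub_ofVec]
  exact fun h => hne (by simp only [h])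

namespace SubmanifoldAtlas

variable {N n : ℕ} {M : Set (Euc N)} {Λ : Type*} {A : SubmanifoldAtlas M n Λ}

theorem ofVec_mem_gDom {a : Λ} {v : Euc N} (hv : v ∈ A.dom a) : ofVec v ∈ A.gDom fun _ => a :=
  gDomC_subset_gDom finite_range_const (ofVec_mem_gDomC hv)

theorem ofVec_mem_gDom_iff {a : Λ} {v : Euc N} (hv : v ∈ M) :
    ofVec v ∈ A.gDom (fun _ => a) ↔ v ∈ A.dom a := by
  refine ⟨fun h => ?_, ofVec_mem_gDom⟩
  exact (eventually_mem_dom h (represents_const v) (by simpa using hv)).exists.choose_spec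

theorem gChart_ofVec (hA : A.IsLipschitz) {a : Λ} {v : Euc N} (hv : v ∈ A.dom a) :
    A.gChart (fun _ => a) (ofVec v) = ofVec (A.chart a v) :=
  (represents_gChart hA finite_range_const (ofVec_mem_gDom hv) (represents_const v)
    (Eventually.of_forall fun _ => dom_subset hv)).2.symm

/-- A classical point lies in the compactly supported part of the domain, hence is regular without
global derivative bounds. For constant nets `netDeriv` is the extension of the classical derivative
by definition. -/
theorem hasGDerivAt_gParam_ofVec (hA : A.IsLipschitz) {a : Λ} {v : Euc N} (hv : v ∈ A.dom a) :
    HasGDerivAt (A.gParam fun _ => a) (extendLinear (fderiv ℝ (A.param a) (A.chart a v)))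
      (ofVec (A.chart a v)) := by
  rw [← gChart_ofVec hA hv]
  exact hasGDerivAt_chartInv hA finite_range_const Subset.rfl (gDom_relOpen _) (ofVec_mem_gDom hv)
    (isRegularAt_of_mem_gDomC finite_range_const (ofVec_mem_gDomC hv)) (represents_const v)
    (Eventually.of_forall fun _ => dom_subset hv)

theorem hasGDerivAt_change_ofVec (hA : A.IsLipschitz) {a b : Λ} {v : Euc N}
    (hv : v ∈ A.dom a ∩ A.dom b) :
    HasGDerivAt (A.gChart (fun _ => b) ∘ A.gParam fun _ => a)
      (extendLinear (fderiv ℝ (A.chart b ∘ A.param a) (A.chart a v))) (ofVec (A.chart a v)) := by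
  rw [← gChart_ofVec hA hv.1]
  exact hasGDerivAt_transition hA finite_range_const finite_range_const Subset.rfl Subset.rfl
    (gDom_relOpen _) (gDom_relOpen _) ⟨ofVec_mem_gDom hv.1, ofVec_mem_gDom hv.2⟩
    (isRegularAt_of_mem_gDomC finite_range_const (ofVec_mem_gDomC hv.1))
    (isRegularAt_of_mem_gDomC finite_range_const (ofVec_mem_gDomC hv.2)) (represents_const v)
    (Eventually.of_forall fun _ => dom_subset hv.1)

theorem iUnion_gDomC : ⋃ l : FinRange Λ, A.gDomC l.1 = tildeC M := by
  refine Subset.antisymm (iUnion_subset fun l p hp => mem_tildeC_of_mem_gDomC l.2 hp) fun p hp => ?_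
  obtain ⟨l, hl, hpl⟩ := exists_mem_gDomC (A := A) hp
  exact mem_iUnion.2 ⟨⟨l, hl⟩, hpl⟩

theorem iUnion_gDom : ⋃ l : FinRange Λ, A.gDom l.1 = tildeC M := by
  refine Subset.antisymm (iUnion_subset fun l => inter_subset_left) ?_
  rw [← iUnion_gDomC (A := A)]
  exact iUnion_mono fun l => gDomC_subset_gDom l.2

end SubmanifoldAtlas

end Colombeau

open Colombeau
theorem mainTheorem7 {N n : ℕ} {Λ : Type*} (M : Set (Euc N)) (hM : M.Nonempty)
    (A : SubmanifoldAtlas M n Λ) (hA : A.IsLipschitz) :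
    -- `M` is a discrete subset of `M̃_c`, a grid of equidistant points
    (ofVec '' M ⊆ tildeC M ∧ DiscreteTopology (ofVec '' M : Set (GVec N)) ∧
      ∀ p ∈ M, ∀ q ∈ M, p ≠ q → ‖ofVec p - ofVec q‖ = 1) ∧
    -- the local charts: well defined, sharp isometries, open domain and image
    (∀ l : Idx → Λ, (Set.range l).Finite →
      (A.gDom l).Nonempty ∧
      (∃ O, IsOpen O ∧ A.gDom l = tildeC M ∩ O) ∧
      (∀ p ∈ A.gDom l, ∀ x, Represents x p → (∀ᶠ ε in small, x ε ∈ M) →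
        Represents (fun ε => A.chart (l ε) (x ε)) (A.gChart l p)) ∧
      (∀ p ∈ A.gDom l, ∀ q ∈ A.gDom l, ‖A.gChart l p - A.gChart l q‖ = ‖p - q‖) ∧
      IsOpen (A.gChart l '' A.gDom l) ∧
      A.gChart l '' A.gDom l ⊆
        stronglyInternal univ (fun ε => A.chart (l ε) '' A.dom (l ε)) ∧
      A.gDomC l ⊆ A.gDom l) ∧
    -- `M̃_c` is covered by the charts
    (⋃ l : FinRange Λ, A.gDom l.1 = tildeC M) ∧
    -- `M̃_c` is a generalized submanifold of codimension `N - n`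
    IsGSubmanifold (N - n) (tildeC M)
      (fun l : FinRange Λ => A.gDomC l.1) (fun l : FinRange Λ => A.gChart l.1) ∧
    (A.HasBoundedDerivatives → IsGSubmanifold (N - n) (tildeC M)
      (fun l : FinRange Λ => A.gDom l.1) (fun l : FinRange Λ => A.gChart l.1)) ∧
    -- the differential structure of `M̃_c` extends that of `M`
    (∀ a, ∀ p ∈ M, (ofVec p ∈ A.gDom (fun _ => a) ↔ p ∈ A.dom a) ∧
      (p ∈ A.dom a → A.gChart (fun _ => a) (ofVec p) = ofVec (A.chart a p) ∧
        HasGDerivAt (A.gParam fun _ => a)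
          (extendLinear (fderiv ℝ (A.param a) (A.chart a p))) (ofVec (A.chart a p)))) ∧
    (∀ a b, ∀ p ∈ A.dom a ∩ A.dom b,
      HasGDerivAt (A.gChart (fun _ => b) ∘ A.gParam fun _ => a)
        (extendLinear (fderiv ℝ (A.chart b ∘ A.param a) (A.chart a p)))
        (ofVec (A.chart a p))) ∧
    -- the distance of `M` extends to `M̃_c`, with the same sharp norm as the ambient distance
    (IsConnected M → ∃ D : GVec N → GVec N → GReal, ∀ p ∈ tildeC M, ∀ q ∈ tildeC M,
      ‖D p q‖ = ‖p - q‖ ∧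
      ∀ x y, Represents x p → Represents y q →
        (∃ K, IsCompact K ∧ K ⊆ M ∧ ∀ᶠ ε in small, x ε ∈ K ∧ y ε ∈ K) →
        IsModerate (fun ε => intrinsicDist M (x ε) (y ε)) ∧
        netClass (fun ε => intrinsicDist M (x ε) (y ε)) = D p q) := by
  refine ⟨⟨?_, discreteTopology_ofVec_image M, fun p _ q _ h => norm_ofVec_sub_ofVec h⟩,
    fun l hl => ⟨?_, SubmanifoldAtlas.gDom_relOpen l,
      fun p hp x hx hxM => SubmanifoldAtlas.represents_gChart hA hl hp hx hxM,
      fun p hp q hq => SubmanifoldAtlas.norm_gChart_sub hA hl hp hq,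
      SubmanifoldAtlas.isOpen_gChart_image hA hl Subset.rfl (SubmanifoldAtlas.gDom_relOpen l),
      SubmanifoldAtlas.gChart_image_subset_stronglyInternal hA hl,
      SubmanifoldAtlas.gDomC_subset_gDom hl⟩,
    SubmanifoldAtlas.iUnion_gDom, ?_, fun hbd => ?_,
    fun a p hp => ⟨SubmanifoldAtlas.ofVec_mem_gDom_iff hp, fun hpa =>
      ⟨SubmanifoldAtlas.gChart_ofVec hA hpa, SubmanifoldAtlas.hasGDerivAt_gParam_ofVec hA hpa⟩⟩,
    fun a b p hp => SubmanifoldAtlas.hasGDerivAt_change_ofVec hA hp,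
    fun hc => SubmanifoldAtlas.exists_generalized_distance hA hc.isPreconnected⟩
  · rintro _ ⟨v, hv, rfl⟩
    exact ofVec_mem_tildeC hv
  · exact (SubmanifoldAtlas.gDomC_nonempty hl).mono (SubmanifoldAtlas.gDomC_subset_gDom hl)
  · exact SubmanifoldAtlas.isGSubmanifold_of_isRegularAt hM hA
      (fun l => SubmanifoldAtlas.gDomC_subset_gDom l.2)
      (fun l => SubmanifoldAtlas.gDomC_nonempty l.2) (fun l => SubmanifoldAtlas.gDomC_relOpen l.2)
      SubmanifoldAtlas.iUnion_gDomC
      fun l p hp => SubmanifoldAtlas.isRegularAt_of_mem_gDomC l.2 hp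
  -- The bounded derivatives make every point of `M̃_c` regular, so the domains need no shrinking.
  · exact SubmanifoldAtlas.isGSubmanifold_of_isRegularAt hM hA (fun l => Subset.rfl)
      (fun l => (SubmanifoldAtlas.gDomC_nonempty l.2).mono
        (SubmanifoldAtlas.gDomC_subset_gDom l.2))
      (fun l => SubmanifoldAtlas.gDom_relOpen l.1) SubmanifoldAtlas.iUnion_gDom
      fun l p hp => SubmanifoldAtlas.HasBoundedDerivatives.isRegularAt hbd hp.1
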